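/- All graphs are finite and simple. A graph is *outer-1-planar* if it has a drawing in the plane (vertices are distinct points, each edge is a simple arc joining its two ends and containing no vertex in its interior) in which every vertex lies on the boundary of the outer (unbounded) face and each edge is crossed at most once. An *$r$-dynamic coloring* of $G$ is a proper vertex coloring in which, for every vertex $v$, at least $\min\{r,d(v)\}$ distinct colors appear on the neighbors of $v$. The graph $G$ is *$r$-dynamic $k$-choosable* if, whenever every vertex $v$ is assigned a list $L(v)$ of exactly $k$ colors, $G$ has an $r$-dynamic coloring $c$ with $c(v)\in L(v)$ for every vertex $v$; the *list $r$-dynamic chromatic number* $ch_r^d(G)$ is the least $k$ for which $G$ is $r$-dynamic $k$-choosable. **Theorem.** Every outer-1-planar graph $G$ is $3$-dynamic $6$-choosable, and hence $ch_3^d(G)\leq 6$. -/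

import Mathlib

namespace SimpleGraph

/-- The Euclidean plane in which graphs are drawn. -/
abbrev Plane : Type := EuclideanSpace ℝ (Fin 2)

/-- A drawing of `G` in the plane: distinct vertices are distinct points, every edge is a simple
(continuous, injective) arc joining the points of its two ends, and no arc passes through the
point of a vertex in its interior. Interiors of distinct arcs may meet; see `crossings`. -/
structure PlaneDrawing {V : Type*} (G : SimpleGraph V) where
  point : V → Plane
  point_injective : Function.Injective point
  arc : G.edgeSet → C(unitInterval, Plane)
  arc_injective : ∀ e, Function.Injective (arc e)
  arc_ends : ∀ e, s(arc e 0, arc e 1) = Sym2.map point (e : Sym2 V)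
  arc_avoids : ∀ e, ∀ t ∈ Set.Ioo (0 : unitInterval) 1, arc e t ∉ Set.range point

namespace PlaneDrawing

variable {V : Type*} {G : SimpleGraph V}

/-- The arc of an edge without its two end points. -/
def arcInterior (D : PlaneDrawing G) (e : G.edgeSet) : Set Plane :=
  D.arc e '' Set.Ioo 0 1

/-- The crossings on the edge `e`: the pairs `(f, p)` such that the edge `f ≠ e` meets `e` at the
point `p`, interior to both arcs. (So a point of `e` that lies on two further edges counts
twice.) -/
def crossings (D : PlaneDrawing G) (e : G.edgeSet) : Set (G.edgeSet × Plane) :=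
  {q | q.1 ≠ e ∧ q.2 ∈ D.arcInterior e ∧ q.2 ∈ D.arcInterior q.1}

/-- The set of all points of the plane covered by the drawing. -/
def support (D : PlaneDrawing G) : Set Plane :=
  Set.range D.point ∪ ⋃ e, Set.range (D.arc e)

/-- The outer face: the unbounded connected component of the complement of the drawing. -/
def outerFace (D : PlaneDrawing G) : Set Plane :=
  {p | p ∈ D.supportᶜ ∧ ¬ Bornology.IsBounded (connectedComponentIn D.supportᶜ p)}

/-- All vertices belong to (the boundary of) the outer face, and there is at most one crossing
on each edge. -/
def IsOuterOnePlane (D : PlaneDrawing G) : Prop :=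
  (∀ v, D.point v ∈ frontier D.outerFace) ∧ ∀ e, (D.crossings e).Subsingleton

end PlaneDrawing

/-- A graph is outer-1-planar if it has a drawing in the plane with all vertices on the outer face
and at most one crossing on each edge. -/
def IsOuterOnePlanar {V : Type*} (G : SimpleGraph V) : Prop :=
  ∃ D : PlaneDrawing G, D.IsOuterOnePlane

/-- An `r`-dynamic coloring: a proper coloring such that at least `min {r, d(v)}` distinct colors
appear on the neighbors of each vertex `v`. -/
def IsDynamicColoring {V C : Type*} (G : SimpleGraph V) (r : ℕ) (c : V → C) : Prop :=
  (∀ u v, G.Adj u v → c u ≠ c v) ∧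
    ∀ v, min (r : ℕ∞) (G.neighborSet v).encard ≤ (c '' G.neighborSet v).encard

/-- `G` is `r`-dynamic `k`-choosable: whenever each vertex gets a list of exactly `k` colors, there
is an `r`-dynamic coloring that picks the color of every vertex from its list. -/
def IsDynamicChoosable {V : Type*} (G : SimpleGraph V) (r k : ℕ) : Prop :=
  ∀ (C : Type) (L : V → Finset C), (∀ v, (L v).card = k) →
    ∃ c : V → C, (∀ v, c v ∈ L v) ∧ G.IsDynamicColoring r c

/-- The list `r`-dynamic chromatic number of `G`: the least `k` for which `G` is `r`-dynamic
`k`-choosable (and `⊤` if there is no such `k`). -/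
noncomputable def listDynamicChromaticNumber {V : Type*} (G : SimpleGraph V) (r : ℕ) : ℕ∞ :=
  ⨅ k ∈ {k : ℕ | G.IsDynamicChoosable r k}, (k : ℕ∞)

end SimpleGraph

/-!
The theorem has a topological and a combinatorial half.

*Topology.* Let all vertices of a drawing lie on the outer face `U`, a connected open set. Then
the vertices have a cyclic order such that any two edges whose ends interleave must cross
(`PlaneDrawing.exists_interleaved_arcs_meet`). To obtain the order, take a round disc in `U`,
choose one point of its boundary for every vertex, and push these points close to the vertices by
a homeomorphism that is the identity off `U` (`exists_homeomorph_of_injective`). Pulling back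
short segments gives disjoint tails which lead from the vertices to the disc within small deformed
discs and so miss all edges at other vertices; the order is that of the points where the tails
arrive. Edges extended by tails run outside the disc, and after inversion they become paths in a
disc with interleaved ends on the circle, which meet by a winding number argument
(`exists_eq_of_interleaved`). Hence an outer-1-planar graph is a graph on a linearly ordered set
in which every edge interleaves at most one other (`IsOuterOnePlanar.exists_isConvexOnePlane`).
Only this is used in the second half.

*Combinatorics.* The coloring is extended step by step into gaps: uncolored intervals between two
colored vertices `p` and `q` of different colors which no edge leaves (`IsGap`). Throughout, the
colored part is a `3`-dynamic coloring of the subgraph it induces. A new vertex of the gap has to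
avoid the colors of `p` and `q` and, if it is adjacent to `p` and `p` sees at most two colors so
far, also these pending colors of `p`; likewise for `q`. These may be six colors in all if the
vertex is adjacent to both ends. The hypothesis `HasRoom` says that this does not occur for a
vertex that is both the last neighbor of `p` and the first neighbor of `q` in the gap, a peak; any
other vertex can be left for later or colored together with a second one. It holds automatically
below an edge `pq` (`hasRoom_of_adj`). By induction on the size of the gap, every gap with room
can be filled (`IsConvexOnePlane.fillable`). Let `x` be the last neighbor of `p` in the gap. If
there is none, or if `px` is not crossed, or if it is crossed by an edge `yz` with `z < q`, then
it suffices to color one vertex and to treat the resulting smaller gaps. If `px` is crossed by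
`yq`, then `x` and `y` are colored together, so that three gaps remain. They are filled in a
suitable order (`IsGap.fill_crossing`), unless all three lie below nonedges and have peaks `l`,
`m`, `r`, and `p` and `q` see at most one color each. In this case the five vertices `l`, `y`,
`m`, `x`, `r` are colored at once, all colors being different except perhaps those of `l` and `r`,
and all six remaining gaps lie below edges (`IsGap.fill_crossing_of_isPeak`). Starting with the
gap between the first and the last vertex, one colors the whole graph.
-/

/-! ### Paths with interleaved ends in the disc -/

section

open unitInterval

/-- If `g` is a path in the closed unit disc that avoids `1`, then `1 - g` stays in the domain of
the principal branch, so a continuous logarithm `l` of `u * (1 - g)` changes from `0` to `1` as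
the principal logarithm of `1 - g` does. -/
theorem Complex.log_lift_increment (l g : C(I, ℂ)) (u : ℂ) (hg : ∀ t, ‖g t‖ ≤ 1)
    (hne : ∀ t, g t ≠ 1) (h : ∀ t, Complex.exp (l t) = u * (1 - g t)) :
    l 1 - l 0 = Complex.log (1 - g 1) - Complex.log (1 - g 0) := by
  have hslit : ∀ t, 1 - g t ∈ Complex.slitPlane := by
    intro t
    left
    have h1 := (Complex.re_le_norm (g t)).trans (hg t)
    rcases h1.lt_or_eq with h2 | h2
    · simpa using h2
    · exfalso
      apply hne t
      have h3 : (g t).re ^ 2 + (g t).im ^ 2 ≤ 1 := by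
        have := Complex.sq_norm (g t)
        rw [Complex.normSq_apply] at this
        nlinarith [hg t, norm_nonneg (g t)]
      have h4 : (g t).im = 0 := by
        rw [h2] at h3
        nlinarith [sq_nonneg (g t).im]
      exact Complex.ext h2 h4
  have hne' : ∀ t, 1 - g t ≠ 0 := fun t => sub_ne_zero.2 (hne t).symm
  have hcont : Continuous fun t => Complex.log (1 - g t) :=
    Continuous.clog (by fun_prop) hslit
  have key : (l : I → ℂ) = fun t => Complex.log (1 - g t) + (l 0 - Complex.log (1 - g 0)) := by
    refine Complex.isCoveringMap_exp.eq_of_comp_eq (by fun_prop) (by fun_prop) ?_ 0 (by simp)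
    funext t
    apply Subtype.ext
    simp only [Function.comp_apply]
    rw [Complex.exp_add, Complex.exp_sub, Complex.exp_log (hne' t), Complex.exp_log (hne' 0), h t,
      h 0]
    field_simp [hne' 0]
  have := congrFun key 1
  rw [this]; ring

theorem Complex.log_one_sub_exp_im {x : ℝ} (h0 : 0 < x) (h1 : x < 2 * Real.pi) :
    (Complex.log (1 - Complex.exp (x * Complex.I))).im = (x - Real.pi) / 2 := by
  have hs : 0 < 2 * Real.sin (x / 2) := by
    have := Real.sin_pos_of_pos_of_lt_pi (x := x / 2) (by linarith) (by linarith)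
    linarith
  have key : 1 - Complex.exp (x * Complex.I) = ((2 * Real.sin (x / 2) : ℝ) : ℂ) *
      (Complex.cos (((x - Real.pi) / 2 : ℝ) : ℂ) +
        Complex.sin (((x - Real.pi) / 2 : ℝ) : ℂ) * Complex.I) := by
    have e1 : (x - Real.pi) / 2 = x / 2 - Real.pi / 2 := by ring
    rw [e1, Complex.exp_mul_I, ← Complex.ofReal_cos, ← Complex.ofReal_sin, ← Complex.ofReal_cos,
      ← Complex.ofReal_sin, Real.cos_sub_pi_div_two, Real.sin_sub_pi_div_two]
    have e2 : x = 2 * (x / 2) := by ring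
    have e3 : Real.cos x = 2 * Real.cos (x / 2) ^ 2 - 1 := by
      rw [← Real.cos_two_mul]; congr 1
    have e4 : Real.sin x = 2 * Real.sin (x / 2) * Real.cos (x / 2) := by
      rw [← Real.sin_two_mul]; congr 1
    have e5 := Real.sin_sq_add_cos_sq (x / 2)
    rw [e3, e4]
    generalize Real.sin (x / 2) = a at *
    generalize Real.cos (x / 2) = b at *
    push_cast
    have e6 : (a : ℂ) ^ 2 + (b : ℂ) ^ 2 = 1 := by exact_mod_cast e5
    linear_combination (-2 : ℂ) * e6
  rw [Complex.log_im, key, Complex.arg_mul_cos_add_sin_mul_I hs]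
  constructor <;> linarith [Real.pi_pos]

/-- Two paths `P` and `Q` in the closed unit disc whose end points are interleaved on the unit
circle meet. Otherwise `P s - Q t` has a continuous logarithm on the unit square. On each side of
the square one of the two paths is constant on the circle, so the change of the imaginary part
along that side can be computed from principal logarithms; the four changes do not add up to
zero. -/
theorem exists_eq_of_interleaved {α β γ δ : ℝ} (h1 : α < β) (h2 : β < γ) (h3 : γ < δ)
    (h4 : δ < α + 2 * Real.pi) (P Q : C(I, ℂ)) (hP : ∀ s, ‖P s‖ ≤ 1) (hQ : ∀ t, ‖Q t‖ ≤ 1)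
    (hP0 : P 0 = Complex.exp (α * Complex.I)) (hP1 : P 1 = Complex.exp (γ * Complex.I))
    (hQ0 : Q 0 = Complex.exp (β * Complex.I)) (hQ1 : Q 1 = Complex.exp (δ * Complex.I)) :
    ∃ s t, P s = Q t := by
  by_contra! hne
  -- the lift is taken on the whole plane, which is locally path connected
  let pr : ℝ → I := Set.projIcc 0 1 zero_le_one
  have hpr : Continuous pr := continuous_projIcc
  let F : C(ℝ × ℝ, ℂ) := ⟨fun z => P (pr z.1) - Q (pr z.2), by fun_prop⟩
  have hF : ∀ z, F z ∈ ({0}ᶜ : Set ℂ) := fun z => by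
    simpa [F, sub_eq_zero] using hne (pr z.1) (pr z.2)
  obtain ⟨m, ⟨-, hm⟩, -⟩ := Complex.isCoveringMapOn_exp.existsUnique_continuousMap_lifts F
    (a₀ := (0, 0)) (e₀ := Complex.log (F (0, 0))) (Complex.exp_log (hF _)) hF
  let l : C(I × I, ℂ) := m.comp ⟨fun z => ((z.1 : ℝ), (z.2 : ℝ)), by fun_prop⟩
  have hl' : ∀ s t, Complex.exp (l (s, t)) = P s - Q t := fun s t => by
    simpa [F, l, pr] using congrFun hm ((s : ℝ), (t : ℝ))
  have hE : ∀ x : ℝ, Complex.exp (x * Complex.I) * Complex.exp (-(x * Complex.I)) = 1 := by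
    intro x; rw [← Complex.exp_add]; simp
  have hnorm : ∀ (x : ℝ) (z : ℂ), ‖z‖ ≤ 1 → ‖Complex.exp (-(x * Complex.I)) * z‖ ≤ 1 := by
    intro x z hz
    have : ‖Complex.exp (-(x * Complex.I))‖ = 1 := by
      simpa using Complex.norm_exp_ofReal_mul_I (-x)
    rw [norm_mul, this, one_mul]; exact hz
  have hne1 : ∀ (x : ℝ) (z : ℂ), Complex.exp (x * Complex.I) ≠ z →
      Complex.exp (-(x * Complex.I)) * z ≠ 1 := by
    intro x z hz h
    apply hz
    calc _ = Complex.exp (x * Complex.I) * (Complex.exp (-(x * Complex.I)) * z) := by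
          rw [h, mul_one]
      _ = z := by rw [← mul_assoc, hE, one_mul]
  -- the value of the logarithm at the corners of the square
  have hval : ∀ x y : ℝ, 0 < y - x → y - x < 2 * Real.pi →
      (Complex.log (1 - Complex.exp (-(x * Complex.I)) * Complex.exp (y * Complex.I))).im
        = (y - x - Real.pi) / 2 := by
    intro x y hx hy
    rw [← Complex.log_one_sub_exp_im hx hy, ← Complex.exp_add]
    congr 5; push_cast; ring
  have hval' : ∀ x y : ℝ, 0 < y - x + 2 * Real.pi → y - x + 2 * Real.pi < 2 * Real.pi →
      (Complex.log (1 - Complex.exp (-(x * Complex.I)) * Complex.exp (y * Complex.I))).im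
        = (y - x + Real.pi) / 2 := by
    intro x y hx hy
    have := hval x (y + 2 * Real.pi) (by linarith) (by linarith)
    rw [show Complex.exp (((y + 2 * Real.pi : ℝ) : ℂ) * Complex.I) = Complex.exp (y * Complex.I) by
      push_cast; rw [add_mul, Complex.exp_add, Complex.exp_two_pi_mul_I, mul_one]] at this
    rw [this]; ring
  have hfac : ∀ (x : ℝ) (z : ℂ), Complex.exp (x * Complex.I) - z
      = Complex.exp (x * Complex.I) * (1 - Complex.exp (-(x * Complex.I)) * z) := by
    intro x z; rw [mul_sub, ← mul_assoc, hE]; ring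
  have s1 := Complex.log_lift_increment (l.comp ⟨fun t => (0, t), by fun_prop⟩)
    ⟨fun t => Complex.exp (-(α * Complex.I)) * Q t, by fun_prop⟩ (Complex.exp (α * Complex.I))
    (fun t => hnorm _ _ (hQ t)) (fun t => hne1 _ _ (hP0 ▸ hne 0 t))
    (fun t => by simp only [ContinuousMap.comp_apply, ContinuousMap.coe_mk, hl', hP0, hfac])
  have s3 := Complex.log_lift_increment (l.comp ⟨fun t => (1, t), by fun_prop⟩)
    ⟨fun t => Complex.exp (-(γ * Complex.I)) * Q t, by fun_prop⟩ (Complex.exp (γ * Complex.I))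
    (fun t => hnorm _ _ (hQ t)) (fun t => hne1 _ _ (hP1 ▸ hne 1 t))
    (fun t => by simp only [ContinuousMap.comp_apply, ContinuousMap.coe_mk, hl', hP1, hfac])
  have s4 := Complex.log_lift_increment (l.comp ⟨fun s => (s, 0), by fun_prop⟩)
    ⟨fun s => Complex.exp (-(β * Complex.I)) * P s, by fun_prop⟩ (-Complex.exp (β * Complex.I))
    (fun t => hnorm _ _ (hP t)) (fun t => hne1 _ _ (hQ0 ▸ (hne t 0).symm))
    (fun t => by
      simp only [ContinuousMap.comp_apply, ContinuousMap.coe_mk, hl', hQ0]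
      rw [neg_mul, ← hfac, neg_sub])
  have s2 := Complex.log_lift_increment (l.comp ⟨fun s => (s, 1), by fun_prop⟩)
    ⟨fun s => Complex.exp (-(δ * Complex.I)) * P s, by fun_prop⟩ (-Complex.exp (δ * Complex.I))
    (fun t => hnorm _ _ (hP t)) (fun t => hne1 _ _ (hQ1 ▸ (hne t 1).symm))
    (fun t => by
      simp only [ContinuousMap.comp_apply, ContinuousMap.coe_mk, hl', hQ1]
      rw [neg_mul, ← hfac, neg_sub])
  -- the four increments cannot close up, as the winding number around the square would be one
  simp only [ContinuousMap.comp_apply, ContinuousMap.coe_mk, hP0, hP1, hQ0, hQ1] at s1 s2 s3 s4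
  replace s1 := congrArg Complex.im s1
  replace s2 := congrArg Complex.im s2
  replace s3 := congrArg Complex.im s3
  replace s4 := congrArg Complex.im s4
  simp only [Complex.sub_im] at s1 s2 s3 s4
  rw [hval _ _ (by linarith) (by linarith), hval _ _ (by linarith) (by linarith)] at s1
  rw [hval' _ _ (by linarith) (by linarith), hval' _ _ (by linarith) (by linarith)] at s2
  rw [hval _ _ (by linarith) (by linarith), hval' _ _ (by linarith) (by linarith)] at s3
  rw [hval _ _ (by linarith) (by linarith), hval' _ _ (by linarith) (by linarith)] at s4
  linarith [Real.pi_pos]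

end

/-! ### Homeomorphisms supported in a connected open set -/

section

open Set Metric Topology

variable {E : Type*} [NormedAddCommGroup E] [NormedSpace ℝ E]

/-- The center of a ball can be moved to any point of the ball by a homeomorphism supported in the
ball: add to `z` the multiple of `y - x` by the tent function `max 0 (1 - ‖z - x‖ / r)`, which is
a perturbation of the identity with Lipschitz constant less than one. -/
theorem exists_homeomorph_of_mem_ball [CompleteSpace E] {x y : E} {r : ℝ} (hy : y ∈ ball x r) :
    ∃ g : E ≃ₜ E, g x = y ∧ ∀ z ∉ ball x r, g z = z := by
  have hr : 0 < r := pos_of_mem_ball hy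
  have hyx : ‖y - x‖ < r := by simpa [dist_eq_norm] using hy
  let φ : E → ℝ := fun z => max 0 (1 - ‖z - x‖ / r)
  let f : E → E := fun z => z + φ z • (y - x)
  have hφ : ∀ z w, |φ z - φ w| ≤ ‖z - w‖ / r := by
    intro z w
    calc |φ z - φ w| ≤ |(1 - ‖z - x‖ / r) - (1 - ‖w - x‖ / r)| := by
          simpa [φ, max_comm] using abs_max_sub_max_le_abs (1 - ‖z - x‖ / r) (1 - ‖w - x‖ / r) 0
      _ = |‖z - x‖ - ‖w - x‖| / r := by
          rw [← abs_of_pos hr, ← abs_div, abs_of_pos hr, abs_sub_comm]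
          congr 1; ring
      _ ≤ ‖z - w‖ / r := by
          gcongr
          simpa using abs_norm_sub_norm_le (z - x) (w - x)
  let c : NNReal := ⟨‖y - x‖ / r, by positivity⟩
  have hf : ApproximatesLinearOn f ((ContinuousLinearEquiv.refl ℝ E : E ≃L[ℝ] E) : E →L[ℝ] E)
      univ c := by
    intro z _ w _
    have : f z - f w - (z - w) = (φ z - φ w) • (y - x) := by
      simp only [f, sub_smul]; abel
    simp only [ContinuousLinearEquiv.coe_refl, ContinuousLinearMap.id_apply]
    change ‖f z - f w - (z - w)‖ ≤ ‖y - x‖ / r * ‖z - w‖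
    rw [this, norm_smul, Real.norm_eq_abs]
    calc |φ z - φ w| * ‖y - x‖ ≤ ‖z - w‖ / r * ‖y - x‖ := by gcongr; exact hφ z w
      _ = _ := by ring
  have hc : Subsingleton E ∨ c < ‖((ContinuousLinearEquiv.refl ℝ E).symm : E →L[ℝ] E)‖₊⁻¹ := by
    rcases subsingleton_or_nontrivial E with h | h
    · exact Or.inl h
    · right
      have : ‖((ContinuousLinearEquiv.refl ℝ E).symm : E →L[ℝ] E)‖₊ = 1 := by
        simp
      rw [this, inv_one, ← NNReal.coe_lt_coe]
      exact (div_lt_one hr).2 hyx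
  refine ⟨hf.toHomeomorph f hc, ?_, ?_⟩
  · change f x = y
    simp [f, φ]
  · intro z hz
    change f z = z
    have : 1 ≤ ‖z - x‖ / r := by
      rw [one_le_div hr]
      simpa [dist_eq_norm] using hz
    simp [f, φ, this]

/-- The homeomorphisms supported in a connected open set act transitively on it. -/
theorem IsPreconnected.exists_homeomorph [CompleteSpace E] {U : Set E} (hU : IsOpen U)
    (hc : IsPreconnected U) {x y : E} (hx : x ∈ U) (hy : y ∈ U) :
    ∃ g : E ≃ₜ E, g x = y ∧ ∀ z ∉ U, g z = z := by
  refine hc.induction₂ (fun a b => ∃ g : E ≃ₜ E, g a = b ∧ ∀ z ∉ U, g z = z) ?_ ?_ ?_ hx hy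
  · intro a ha
    obtain ⟨r, hr, hb⟩ := Metric.isOpen_iff.1 hU a ha
    filter_upwards [mem_nhdsWithin_of_mem_nhds (ball_mem_nhds a hr)] with b hb'
    obtain ⟨g, h1, h2⟩ := exists_homeomorph_of_mem_ball hb'
    exact ⟨g, h1, fun z hz => h2 z fun h => hz (hb h)⟩
  · rintro a b d - - - ⟨g, h1, h2⟩ ⟨g', h1', h2'⟩
    exact ⟨g.trans g', by simp [h1, h1'], fun z hz => by simp [h2 z hz, h2' z hz]⟩
  · rintro a b - - ⟨g, h1, h2⟩
    exact ⟨g.symm, by simp [← h1], fun z hz => by rw [Homeomorph.symm_apply_eq, h2 z hz]⟩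

theorem isPreconnected_ball_diff_center (h : 1 < Module.rank ℝ E) (x : E) (r : ℝ) :
    IsPreconnected (ball x r \ {x}) := by
  have : ball x r \ {x} = (fun z : ℝ × E => x + z.1 • z.2) '' (Ioo 0 r ×ˢ sphere 0 1) := by
    ext y
    simp only [mem_sdiff, mem_ball, mem_singleton_iff, mem_image, mem_prod, mem_Ioo,
      mem_sphere_zero_iff_norm, Prod.exists, dist_eq_norm]
    constructor
    · rintro ⟨h1, h2⟩
      have h3 : 0 < ‖y - x‖ := norm_pos_iff.2 (sub_ne_zero.2 h2)
      exact ⟨‖y - x‖, ‖y - x‖⁻¹ • (y - x), ⟨⟨h3, h1⟩, by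
        rw [norm_smul, norm_inv, norm_norm, inv_mul_cancel₀ h3.ne']⟩, by
        rw [smul_inv_smul₀ h3.ne', add_sub_cancel]⟩
    · rintro ⟨a, b, ⟨⟨h1, h2⟩, h3⟩, rfl⟩
      have h4 : ‖x + a • b - x‖ = a := by
        rw [add_sub_cancel_left, norm_smul, h3, mul_one, Real.norm_eq_abs, abs_of_pos h1]
      refine ⟨by rwa [h4], fun h5 => ?_⟩
      rw [h5, sub_self, norm_zero] at h4
      exact h1.ne h4
  rw [this]
  exact (isPreconnected_Ioo.prod (isPreconnected_sphere h 0 1)).image _ (by fun_prop)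

/-- Removing a point from a connected open set keeps it connected in dimension at least two. -/
theorem IsPreconnected.diff_singleton_of_isOpen (h : 1 < Module.rank ℝ E) {U : Set E}
    (hU : IsOpen U) (hc : IsPreconnected U) (x : E) : IsPreconnected (U \ {x}) := by
  by_cases hx : x ∈ U
  swap
  · rwa [sdiff_singleton_eq_self hx]
  obtain ⟨r, hr, hb⟩ := Metric.isOpen_iff.1 hU x hx
  have hpb := isPreconnected_ball_diff_center h x r
  have hUx : IsOpen (U \ {x}) := hU.sdiff isClosed_singleton
  rw [isPreconnected_iff_subset_of_disjoint]
  intro A B hA hB hAB hdis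
  have hsub : ball x r \ {x} ⊆ U \ {x} := sdiff_subset_sdiff_left hb
  -- the part containing the punctured ball stays open after the centre is put back
  have key : ∀ A B : Set E, IsOpen A → IsOpen B → U \ {x} ⊆ A ∪ B → U \ {x} ∩ (A ∩ B) = ∅ →
      ball x r \ {x} ⊆ A → U \ {x} ⊆ A ∨ U \ {x} ⊆ B := by
    intro A B hA hB hAB hdis hbA
    have := isPreconnected_iff_subset_of_disjoint.1 hc (A ∪ ball x r) (B ∩ (U \ {x}))
      (hA.union isOpen_ball) (hB.inter hUx) ?_ ?_
    · rcases this with h1 | h1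
      · left
        intro y hy
        rcases h1 hy.1 with h2 | h2
        · exact h2
        · exact hbA ⟨h2, hy.2⟩
      · exact absurd rfl (h1 hx).2.2
    · intro y hy
      by_cases hyx : y = x
      · left; right; rw [hyx]; exact mem_ball_self hr
      · rcases hAB ⟨hy, hyx⟩ with h1 | h1
        · exact Or.inl (Or.inl h1)
        · exact Or.inr ⟨h1, hy, hyx⟩
    · rw [eq_empty_iff_forall_notMem] at hdis ⊢
      rintro y ⟨hy, h1, h2, h3⟩
      rcases h1 with h1 | h1
      · exact hdis y ⟨h3, h1, h2⟩
      · exact hdis y ⟨h3, hbA ⟨h1, h3.2⟩, h2⟩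
  rcases isPreconnected_iff_subset_of_disjoint.1 hpb A B hA hB (hsub.trans hAB)
    (by
      rw [eq_empty_iff_forall_notMem] at hdis ⊢
      exact fun y hy => hdis y ⟨hsub hy.1, hy.2⟩) with h1 | h1
  · exact key A B hA hB hAB hdis h1
  · exact (key B A hB hA (by rwa [union_comm]) (by rwa [inter_comm B A]) h1).symm

theorem IsPreconnected.diff_finite_of_isOpen (h : 1 < Module.rank ℝ E) {U F : Set E}
    (hF : F.Finite) (hU : IsOpen U) (hc : IsPreconnected U) : IsPreconnected (U \ F) := by
  induction F, hF using Set.Finite.induction_on with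
  | empty => simpa using hc
  | @insert a s _ hs ih =>
    have := ih.diff_singleton_of_isOpen h (hU.sdiff hs.isClosed) a
    rwa [sdiff_sdiff, union_singleton] at this

/-- In dimension at least two, finitely many points of a connected open set `U` can be moved
simultaneously to prescribed distinct points of `U` by a homeomorphism supported in `U`. The
points are moved one after the other, each time within `U` minus the points already in place. -/
theorem exists_homeomorph_of_injective [CompleteSpace E] (h : 1 < Module.rank ℝ E) {U : Set E}
    (hU : IsOpen U) (hc : IsPreconnected U) {ι : Type*} (s : Finset ι) (b w : ι → E)
    (hb : Function.Injective b) (hw : Function.Injective w) (hbU : ∀ i, b i ∈ U)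
    (hwU : ∀ i, w i ∈ U) :
    ∃ g : E ≃ₜ E, (∀ i ∈ s, g (b i) = w i) ∧ ∀ z ∉ U, g z = z := by
  classical
  induction s using Finset.induction_on with
  | empty => exact ⟨Homeomorph.refl E, by simp, by simp⟩
  | insert a s ha ih =>
    obtain ⟨g, h1, h2⟩ := ih
    have hfin : (w '' s).Finite := s.finite_toSet.image w
    have hgU : ∀ z ∈ U, g z ∈ U := by
      intro z hz
      by_contra hn
      rw [g.injective (h2 _ hn)] at hn
      exact hn hz
    obtain ⟨g', h1', h2'⟩ := (hc.diff_finite_of_isOpen h hfin hU).exists_homeomorph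
      (hU.sdiff hfin.isClosed) (x := g (b a)) (y := w a)
      ⟨hgU _ (hbU a), by
        rintro ⟨i, hi, hia⟩
        rw [← h1 i hi] at hia
        exact ha (hb (g.injective hia) ▸ hi)⟩
      ⟨hwU a, by
        rintro ⟨i, hi, hia⟩
        exact ha (hw hia ▸ hi)⟩
    refine ⟨g.trans g', ?_, ?_⟩
    · intro i hi
      rcases Finset.mem_insert.1 hi with rfl | hi
      · simpa using h1'
      · have : w i ∉ U \ w '' s := fun hn => hn.2 ⟨i, hi, rfl⟩
        simp [h1 i hi, h2' _ this]
    · intro z hz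
      simp [h2 z hz, h2' z fun hn => hz hn.1]

theorem isPreconnected_compl_closedBall (h : 1 < Module.rank ℝ E) (R : ℝ) (hR : 0 ≤ R) :
    IsPreconnected (closedBall (0 : E) R)ᶜ := by
  have : (closedBall (0 : E) R)ᶜ = (fun z : ℝ × E => z.1 • z.2) '' (Ioi R ×ˢ sphere 0 1) := by
    ext y
    simp only [mem_compl_iff, mem_closedBall_zero_iff, not_le, mem_image, mem_prod, mem_Ioi,
      mem_sphere_zero_iff_norm, Prod.exists]
    constructor
    · intro h1
      have h3 : 0 < ‖y‖ := hR.trans_lt h1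
      exact ⟨‖y‖, ‖y‖⁻¹ • y, ⟨h1, by
        rw [norm_smul, norm_inv, norm_norm, inv_mul_cancel₀ h3.ne']⟩, smul_inv_smul₀ h3.ne' y⟩
    · rintro ⟨a, b, ⟨h1, h3⟩, rfl⟩
      rwa [norm_smul, h3, mul_one, Real.norm_eq_abs, abs_of_pos (hR.trans_lt h1)]
  rw [this]
  exact (isPreconnected_Ioi.prod (isPreconnected_sphere h 0 1)).image _ (by fun_prop)

end

/-! ### The cyclic order on the boundary of a connected open set -/

section

open Set Metric Topology unitInterval

/-- Finitely many points `v i` on the boundary of a connected open set `U` have a cyclic order,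
given by angles `θ i`, in which connections outside `U` behave like chords of a circle: two paths
with interleaved ends meet. The closed sets `K e`, disjoint from `U`, are there to carry the
paths; the angles do not depend on the paths.

A homeomorphism `g` supported in `U` moves points `b i` of a round circle in `U` close to the
`v i`. The images under `g⁻¹` of the short segments from `v i` to `g (b i)`, cut off where they
first hit the circle, are disjoint tails from the `v i` to points of the circle, whose angles are
the `θ i`. Paths extended by these tails run outside the disc, and inversion maps them into the
disc, where `exists_eq_of_interleaved` applies. The common point cannot lie on a tail. -/
theorem exists_cyclic_order_of_paths {ι κ : Type*} [Finite ι] [Finite κ] {v : ι → ℂ}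
    (hv : Function.Injective v) {U : Set ℂ} (hU : IsOpen U) (hc : IsPreconnected U)
    (hne : U.Nonempty) (hvU : ∀ i, v i ∈ closure U) (hvn : ∀ i, v i ∉ U) (K : κ → Set ℂ)
    (hK : ∀ e, IsClosed (K e)) (hKU : ∀ e, Disjoint (K e) U) :
    ∃ θ : ι → ℝ, Function.Injective θ ∧ ∀ e f i j k l (α : Path (v i) (v j))
      (β : Path (v k) (v l)), range α ⊆ K e → range β ⊆ K f → v k ∉ K e → v l ∉ K e →
      v i ∉ K f → v j ∉ K f → θ i < θ k → θ k < θ j → θ j < θ l → (range α ∩ range β).Nonempty := by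
  have := Fintype.ofFinite ι
  -- radius of the discs around the vertices
  obtain ⟨ε, hε, hε1, hε2⟩ : ∃ ε > 0, (∀ i j, i ≠ j → Disjoint (ball (v i) ε) (ball (v j) ε)) ∧
      ∀ e i, v i ∉ K e → Disjoint (ball (v i) ε) (K e) := by
    have h1 : ∀ᶠ ε in 𝓝[>] (0 : ℝ), ∀ i j, i ≠ j → Disjoint (ball (v i) ε) (ball (v j) ε) := by
      simp only [Filter.eventually_all]
      intro i j hij
      have hd : 0 < dist (v i) (v j) / 2 := half_pos (dist_pos.2 (hv.ne hij))
      filter_upwards [Ioo_mem_nhdsGT hd] with ε hε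
      exact ball_disjoint_ball (by linarith [hε.2])
    have h2 : ∀ᶠ ε in 𝓝[>] (0 : ℝ), ∀ e i, v i ∉ K e → Disjoint (ball (v i) ε) (K e) := by
      simp only [Filter.eventually_all]
      intro e i hi
      obtain ⟨r, hr, hb⟩ := Metric.isOpen_iff.1 (hK e).isOpen_compl _ hi
      filter_upwards [Ioo_mem_nhdsGT hr] with ε hε
      exact Set.disjoint_left.2 fun x hx => hb (ball_subset_ball hε.2.le hx)
    obtain ⟨ε, ⟨h3, h4⟩, h5⟩ := ((h1.and h2).and self_mem_nhdsWithin).exists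
    exact ⟨ε, h5, h3, h4⟩
  have hw : ∀ i, ∃ w ∈ U, w ∈ ball (v i) ε := fun i => by
    obtain ⟨w, hw, hd⟩ := Metric.mem_closure_iff.1 (hvU i) ε hε
    exact ⟨w, hw, by rwa [mem_ball, dist_comm]⟩
  choose w hwU hwb using hw
  have hballs : ∀ i j x, x ∈ ball (v i) ε → x ∈ ball (v j) ε → i = j := by
    intro i j x h1 h2
    by_contra hij
    exact Set.disjoint_left.1 (hε1 i j hij) h1 h2
  have hwinj : Function.Injective w := fun i j hij => hballs i j (w i) (hwb i) (hij ▸ hwb j)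
  -- a round disc in `U`, with one marked boundary point for every vertex
  obtain ⟨z₀, hz₀⟩ := hne
  obtain ⟨r, hr, hrU⟩ : ∃ r > 0, closedBall z₀ r ⊆ U :=
    nhds_basis_closedBall.mem_iff.1 (hU.mem_nhds hz₀)
  have hinf : (sphere z₀ r).Infinite := by
    refine (isPreconnected_sphere (by simp) z₀ r).infinite_of_nontrivial ?_
    refine ⟨z₀ + r, by simp [abs_of_pos hr], z₀ - r, by simp [abs_of_pos hr], fun h => ?_⟩
    have : (r : ℂ) = 0 := by linear_combination h / 2
    exact hr.ne' (by exact_mod_cast this)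
  have := hinf.to_subtype
  let b : ι → ℂ := fun i => (Infinite.natEmbedding (sphere z₀ r) (Fintype.equivFin ι i) : ℂ)
  have hbS : ∀ i, dist (b i) z₀ = r := fun i => (Infinite.natEmbedding (sphere z₀ r) _).2
  have hbinj : Function.Injective b := fun i j hij =>
    (Fintype.equivFin ι).injective
      (Fin.ext ((Infinite.natEmbedding (sphere z₀ r)).injective (Subtype.ext hij)))
  obtain ⟨g, hg1, hg2⟩ := exists_homeomorph_of_injective (by simp) hU hc Finset.univ b w hbinj
    hwinj (fun i => hrU (by simp [hbS])) hwU
  -- `ρ i` leads from `v i` to `b i` and stays in the preimage of a small disc around `v i`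
  let ρ : ι → C(I, ℂ) := fun i =>
    ⟨fun t => g.symm (AffineMap.lineMap (v i) (w i) (t : ℝ)), by
      have : Continuous fun t : I => AffineMap.lineMap (k := ℝ) (v i) (w i) (t : ℝ) :=
        AffineMap.lineMap_continuous.comp continuous_subtype_val
      exact g.symm.continuous.comp this⟩
  have hρb : ∀ i t, g (ρ i t) ∈ ball (v i) ε := by
    intro i t
    simp only [ρ, ContinuousMap.coe_mk, Homeomorph.apply_symm_apply]
    exact (convex_ball (v i) ε).lineMap_mem (mem_ball_self hε) (hwb i) t.2
  have hρ0 : ∀ i, ρ i 0 = v i := by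
    intro i
    simp [ρ, Homeomorph.symm_apply_eq, hg2 _ (hvn i)]
  have hρ1 : ∀ i, ρ i 1 = b i := by
    intro i
    simp [ρ, Homeomorph.symm_apply_eq, hg1]
  -- the first point of the disc on the way from the vertex
  have hfirst : ∀ i, ∃ t : I, dist (ρ i t) z₀ = r ∧ ∀ s ≤ t, r ≤ dist (ρ i s) z₀ := by
    intro i
    have hcl : IsClosed {t : I | dist (ρ i t) z₀ = r} :=
      isClosed_eq (by fun_prop) continuous_const
    obtain ⟨t, ht, hmin⟩ := hcl.isCompact.exists_isLeast ⟨1, by simp [hρ1, hbS]⟩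
    refine ⟨t, ht, fun s hs => ?_⟩
    by_contra! hlt
    have h0 : r ≤ dist (ρ i 0) z₀ := by
      by_contra! h
      exact hvn i (hrU (by rw [← hρ0 i]; exact h.le))
    have hcont : ContinuousOn (fun t => dist (ρ i t) z₀) (Icc 0 s) :=
      Continuous.continuousOn (by fun_prop)
    obtain ⟨u, hu, hur⟩ := intermediate_value_Icc' (nonneg' (t := s)) hcont ⟨hlt.le, h0⟩
    have : u = s := le_antisymm hu.2 (hs.trans (hmin hur))
    rw [this] at hur
    exact hlt.ne hur
  choose T hT1 hT2 using hfirst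
  let c : ι → ℂ := fun i => ρ i (T i)
  have hcinj : Function.Injective c := fun i j hij =>
    hballs i j (g (c i)) (hρb i _) (by rw [hij]; exact hρb j _)
  let τ : ∀ i, Path (v i) (c i) := fun i =>
    { toFun := fun s => ρ i (T i * s)
      continuous_toFun := by fun_prop
      source' := by simp [hρ0]
      target' := by simp [c] }
  have hτr : ∀ i, ∀ z ∈ range (τ i), r ≤ dist z z₀ := by
    rintro i _ ⟨s, rfl⟩
    exact hT2 i _ mul_le_left
  have hτb : ∀ i, ∀ z ∈ range (τ i), g z ∈ ball (v i) ε := by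
    rintro i _ ⟨s, rfl⟩
    exact hρb i _
  have hKr : ∀ e, ∀ z ∈ K e, r ≤ dist z z₀ := by
    intro e z hz
    by_contra! h
    exact Set.disjoint_left.1 (hKU e) hz (hrU h.le)
  have hKg : ∀ e, ∀ z ∈ K e, g z = z := fun e z hz =>
    hg2 z (Set.disjoint_left.1 (hKU e) hz)
  let θ : ι → ℝ := fun i => Complex.arg (c i - z₀)
  have hθ : ∀ i, c i - z₀ = r * Complex.exp (θ i * Complex.I) := by
    intro i
    have := Complex.norm_mul_exp_arg_mul_I (c i - z₀)
    rw [← dist_eq_norm, show dist (c i) z₀ = r from hT1 i] at this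
    exact this.symm
  refine ⟨θ, fun i j hij => hcinj ?_, ?_⟩
  · have := hθ i
    rw [hij, ← hθ j] at this
    exact sub_left_injective this
  intro e f i j k l α β hα hβ hk hl hi hj h1 h2 h3
  -- inversion in the circle maps the outside of the disc into the unit disc
  let J : ℂ → ℂ := fun z => r / (starRingEnd ℂ) (z - z₀)
  have hpath : ∀ (e : κ) (i j : ι) (α : Path (v i) (v j)), range α ⊆ K e →
      ∃ P : C(I, ℂ), (∀ t, ‖P t‖ ≤ 1) ∧ P 0 = Complex.exp (θ i * Complex.I) ∧
        P 1 = Complex.exp (θ j * Complex.I) ∧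
        ∀ t, ∃ z, z ≠ z₀ ∧ P t = J z ∧ (z ∈ range (τ i) ∨ z ∈ range α ∨ z ∈ range (τ j)) := by
    intro e i j α hα
    let p : Path (c i) (c j) := (τ i).symm.trans (α.trans (τ j))
    have hp : ∀ t, p t ∈ range (τ i) ∨ p t ∈ range α ∨ p t ∈ range (τ j) := by
      intro t
      have : p t ∈ range p := ⟨t, rfl⟩
      simpa only [p, Path.trans_range, Path.symm_range, mem_union] using this
    have hpr : ∀ t, r ≤ dist (p t) z₀ := by
      intro t
      rcases hp t with h | h | h
      · exact hτr _ _ h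
      · exact hKr e _ (hα h)
      · exact hτr _ _ h
    have hp0 : ∀ t, p t ≠ z₀ := by
      intro t h
      have := hpr t
      rw [h, dist_self] at this
      linarith
    have hJc : ∀ i, J (c i) = Complex.exp (θ i * Complex.I) := by
      intro i
      have hr' : (r : ℂ) ≠ 0 := by exact_mod_cast hr.ne'
      simp only [J]
      rw [hθ i, map_mul, Complex.conj_ofReal, ← Complex.exp_conj, map_mul, Complex.conj_I,
        Complex.conj_ofReal, mul_neg, Complex.exp_neg]
      field_simp
    refine ⟨⟨fun t => J (p t), ?_⟩, ?_, ?_, ?_, fun t => ⟨p t, hp0 t, rfl, hp t⟩⟩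
    · refine Continuous.div continuous_const ?_ fun t => ?_
      · exact Complex.continuous_conj.comp (by fun_prop)
      · rw [map_ne_zero]
        exact sub_ne_zero.2 (hp0 t)
    · intro t
      have h := hpr t
      simp only [ContinuousMap.coe_mk, J, norm_div, RCLike.norm_conj, Complex.norm_real,
        Real.norm_eq_abs, abs_of_pos hr]
      rw [dist_eq_norm] at h
      exact (div_le_one (hr.trans_le h)).2 h
    · simpa using hJc i
    · simpa using hJc j
  obtain ⟨P, hP, hP0, hP1, hPz⟩ := hpath e i j α hα
  obtain ⟨Q, hQ, hQ0, hQ1, hQz⟩ := hpath f k l β hβ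
  obtain ⟨s, t, hst⟩ := exists_eq_of_interleaved h1 h2 h3
    (by linarith [(Complex.arg_mem_Ioc (c l - z₀)).2, (Complex.arg_mem_Ioc (c i - z₀)).1]) P Q hP hQ
    hP0 hP1 hQ0 hQ1
  obtain ⟨z, hz, hz1, hz2⟩ := hPz s
  obtain ⟨z', hz', hz1', hz2'⟩ := hQz t
  have hzz : z = z' := by
    have hr' : (r : ℂ) ≠ 0 := by exact_mod_cast hr.ne'
    have : J z = J z' := by rw [← hz1, ← hz1', hst]
    exact (starRingEnd ℂ).injective (by simpa [J, div_eq_mul_inv, hr'] using this)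
  subst hzz
  have hττ : ∀ a b, a ≠ b → z ∈ range (τ a) → z ∈ range (τ b) → False := fun a b hab ha hb =>
    hab (hballs a b _ (hτb a z ha) (hτb b z hb))
  have hτK : ∀ a e, v a ∉ K e → z ∈ range (τ a) → z ∈ K e → False := fun a e hae ha he => by
    have := hτb a z ha
    rw [hKg e z he] at this
    exact Set.disjoint_left.1 (hε2 e a hae) this he
  have n1 : i ≠ k := fun h => by rw [h] at h1; exact lt_irrefl _ h1
  have n2 : k ≠ j := fun h => by rw [h] at h2; exact lt_irrefl _ h2
  have n3 : j ≠ l := fun h => by rw [h] at h3; exact lt_irrefl _ h3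
  have n4 : i ≠ l := fun h => by rw [h] at h1; exact lt_irrefl _ (h1.trans (h2.trans h3))
  rcases hz2 with h | h | h <;> rcases hz2' with h' | h' | h'
  · exact (hττ _ _ n1 h h').elim
  · exact (hτK _ _ hi h (hβ h')).elim
  · exact (hττ _ _ n4 h h').elim
  · exact (hτK _ _ hk h' (hα h)).elim
  · exact ⟨z, h, h'⟩
  · exact (hτK _ _ hl h' (hα h)).elim
  · exact (hττ _ _ n2.symm h h').elim
  · exact (hτK _ _ hj h (hβ h')).elim
  · exact (hττ _ _ n3 h h').elim

end

/-! ### From outer-1-plane drawings to convex drawings -/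

section

open Set Metric Topology unitInterval

namespace SimpleGraph

namespace PlaneDrawing

variable {V : Type*} {G : SimpleGraph V} (D : PlaneDrawing G)

theorem isCompact_support [Finite V] : IsCompact D.support := by
  have : Finite G.edgeSet := inferInstance
  exact (finite_range D.point).isCompact.union
    (isCompact_iUnion fun e => isCompact_range (D.arc e).continuous)

theorem isOpen_outerFace [Finite V] : IsOpen D.outerFace := by
  rw [isOpen_iff_forall_mem_open]
  rintro p ⟨hp, hb⟩
  refine ⟨connectedComponentIn D.supportᶜ p, fun q hq => ⟨connectedComponentIn_subset _ _ hq, ?_⟩,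
    D.isCompact_support.isClosed.isOpen_compl.connectedComponentIn, mem_connectedComponentIn hp⟩
  rwa [← connectedComponentIn_eq hq]

theorem isPreconnected_outerFace [Finite V] : IsPreconnected D.outerFace := by
  obtain ⟨R, hR, hsub⟩ := D.isCompact_support.isBounded.subset_closedBall_lt 0 0
  have hrank : 1 < Module.rank ℝ Plane := by simp [← Module.finrank_eq_rank]
  have hpre := isPreconnected_compl_closedBall hrank R hR.le
  -- every unbounded component contains the complement of a large disc
  have key : ∀ p ∈ D.outerFace,
      (closedBall (0 : Plane) R)ᶜ ⊆ connectedComponentIn D.supportᶜ p := by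
    rintro p ⟨-, hb⟩
    obtain ⟨q, hq, hqR⟩ := not_subset.1 fun h => hb (isBounded_closedBall.subset h)
    rw [connectedComponentIn_eq hq]
    exact hpre.subset_connectedComponentIn hqR (compl_subset_compl.2 hsub)
  refine isPreconnected_of_forall_pair fun x hx y hy => ?_
  refine ⟨connectedComponentIn D.supportᶜ x, fun z hz =>
    ⟨connectedComponentIn_subset _ _ hz, by rw [← connectedComponentIn_eq hz]; exact hx.2⟩,
    mem_connectedComponentIn hx.1, ?_, isPreconnected_connectedComponentIn⟩
  obtain ⟨q, hq⟩ : ((closedBall (0 : Plane) R)ᶜ).Nonempty := by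
    by_contra! h
    exact hx.2 (isBounded_closedBall.subset
      ((compl_empty_iff.1 h).symm ▸ subset_univ _ : _ ⊆ closedBall (0 : Plane) R))
  rw [connectedComponentIn_eq (key x hx hq), ← connectedComponentIn_eq (key y hy hq)]
  exact mem_connectedComponentIn hy.1

theorem exists_path {e : G.edgeSet} {a b : V} (h : (e : Sym2 V) = s(a, b)) :
    ∃ α : _root_.Path (D.point a) (D.point b), range α = range (D.arc e) := by
  have h1 := D.arc_ends e
  rw [h, Sym2.map_mk, Sym2.eq_iff] at h1
  rcases h1 with h1 | h1
  · exact ⟨⟨D.arc e, h1.1, h1.2⟩, rfl⟩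
  · exact ⟨(⟨D.arc e, h1.1, h1.2⟩ : _root_.Path (D.point b) (D.point a)).symm,
      _root_.Path.symm_range _⟩

theorem mem_arcInterior_or {e : G.edgeSet} {a b : V} (h : (e : Sym2 V) = s(a, b)) {p : Plane}
    (hp : p ∈ range (D.arc e)) : p ∈ D.arcInterior e ∨ p = D.point a ∨ p = D.point b := by
  obtain ⟨t, rfl⟩ := hp
  have h1 := D.arc_ends e
  rw [h, Sym2.map_mk, Sym2.eq_iff] at h1
  rcases eq_or_ne t 0 with rfl | h0
  · tauto
  rcases eq_or_ne t 1 with rfl | h1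
  · tauto
  exact Or.inl ⟨t, ⟨unitInterval.pos_iff_ne_zero.2 h0, unitInterval.lt_one_iff_ne_one.2 h1⟩, rfl⟩

theorem point_notMem_range_arc {e : G.edgeSet} {a b c : V} (h : (e : Sym2 V) = s(a, b))
    (ha : c ≠ a) (hb : c ≠ b) : D.point c ∉ range (D.arc e) := by
  intro hc
  rcases D.mem_arcInterior_or h hc with ⟨t, ht, h1⟩ | h1 | h1
  · exact D.arc_avoids e t ht ⟨c, h1.symm⟩
  · exact ha (D.point_injective h1)
  · exact hb (D.point_injective h1)

/-- If all vertices lie on the outer face, then they have a cyclic order in which the arcs of any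
two edges with interleaved ends cross. -/
theorem exists_interleaved_arcs_meet [Finite V]
    (hD : ∀ v, D.point v ∈ frontier D.outerFace) :
    ∃ θ : V → ℝ, Function.Injective θ ∧ ∀ (e f : G.edgeSet) (a b c d : V),
      (e : Sym2 V) = s(a, b) → (f : Sym2 V) = s(c, d) → θ a < θ c → θ c < θ b → θ b < θ d →
      (D.arcInterior e ∩ D.arcInterior f).Nonempty := by
  rcases isEmpty_or_nonempty V with hV | ⟨⟨v₀⟩⟩
  · exact ⟨isEmptyElim, fun a => isEmptyElim a, fun _ _ a => isEmptyElim a⟩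
  let Φ : Plane ≃ₜ ℂ := Complex.orthonormalBasisOneI.repr.symm.toHomeomorph
  have hcl : ∀ v, D.point v ∈ closure D.outerFace := fun v => frontier_subset_closure (hD v)
  obtain ⟨θ, hθ, h⟩ := exists_cyclic_order_of_paths (v := fun v => Φ (D.point v))
    (Φ.injective.comp D.point_injective) (U := Φ '' D.outerFace)
    (Φ.isOpenMap _ D.isOpen_outerFace)
    (D.isPreconnected_outerFace.image _ Φ.continuous.continuousOn)
    ((closure_nonempty_iff.1 ⟨_, hcl v₀⟩).image _)
    (fun v => by
      rw [← Φ.image_closure]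
      exact mem_image_of_mem _ (hcl v))
    (fun v => by
      rw [Φ.injective.mem_set_image]
      exact fun hv => hv.1 (Or.inl ⟨v, rfl⟩))
    (fun e : G.edgeSet => Φ '' range (D.arc e))
    (fun e => ((isCompact_range (D.arc e).continuous).image Φ.continuous).isClosed)
    (fun e => by
      rw [Set.disjoint_image_iff Φ.injective]
      refine Set.disjoint_left.2 fun p hp hp' => hp'.1 (Or.inr ?_)
      exact mem_iUnion.2 ⟨e, hp⟩)
  refine ⟨θ, hθ, fun e f a b c d he hf h1 h2 h3 => ?_⟩
  obtain ⟨α, hα⟩ := D.exists_path he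
  obtain ⟨β, hβ⟩ := D.exists_path hf
  have n1 : a ≠ c := fun h => by rw [h] at h1; exact lt_irrefl _ h1
  have n2 : c ≠ b := fun h => by rw [h] at h2; exact lt_irrefl _ h2
  have n3 : b ≠ d := fun h => by rw [h] at h3; exact lt_irrefl _ h3
  have n4 : a ≠ d := fun h => by rw [h] at h1; exact lt_irrefl _ (h1.trans (h2.trans h3))
  have hr : ∀ {x y : V} (γ : _root_.Path (D.point x) (D.point y)),
      range (γ.map Φ.continuous) = Φ '' range γ := fun γ => by rw [_root_.Path.map_coe, range_comp]
  have hm : ∀ (x : V) (e : G.edgeSet), D.point x ∉ range (D.arc e) →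
      Φ (D.point x) ∉ Φ '' range (D.arc e) := fun x e hx => by
    rwa [Φ.injective.mem_set_image]
  obtain ⟨z, hz1, hz2⟩ := h e f a b c d (α.map Φ.continuous) (β.map Φ.continuous)
    (by rw [hr, hα]) (by rw [hr, hβ]) (hm _ _ (D.point_notMem_range_arc he n1.symm n2))
    (hm _ _ (D.point_notMem_range_arc he n4.symm n3.symm))
    (hm _ _ (D.point_notMem_range_arc hf n1 n4)) (hm _ _ (D.point_notMem_range_arc hf n2.symm n3))
    h1 h2 h3
  rw [hr, hα] at hz1
  rw [hr, hβ] at hz2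
  obtain ⟨p, hp, rfl⟩ := hz1
  rw [Φ.injective.mem_set_image] at hz2
  refine ⟨p, ?_, ?_⟩
  · rcases D.mem_arcInterior_or he hp with h | rfl | rfl
    · exact h
    · exact absurd hz2 (D.point_notMem_range_arc hf n1 n4)
    · exact absurd hz2 (D.point_notMem_range_arc hf n2.symm n3)
  · rcases D.mem_arcInterior_or hf hz2 with h | rfl | rfl
    · exact h
    · exact absurd hp (D.point_notMem_range_arc he n1.symm n2)
    · exact absurd hp (D.point_notMem_range_arc he n4.symm n3.symm)

end PlaneDrawing

/-- The chords `ab` and `cd` of a convex polygon with linearly ordered vertices cross, where `a`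
and `c` are the smaller ends. -/
def Crosses {V : Type*} [LinearOrder V] (a b c d : V) : Prop :=
  a < c ∧ c < b ∧ b < d ∨ c < a ∧ a < d ∧ d < b

/-- The edges of `G`, drawn as chords of a convex polygon whose vertices appear in the given
order, are crossed at most once each. -/
def IsConvexOnePlane {V : Type*} [LinearOrder V] (G : SimpleGraph V) : Prop :=
  ∀ a b c d c' d' : V, G.Adj a b → G.Adj c d → G.Adj c' d' → Crosses a b c d →
    Crosses a b c' d' → c = c' ∧ d = d'

/-- An outer-1-planar graph can be drawn with straight edges on the vertices of a convex polygon,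
every edge being crossed at most once. -/
theorem IsOuterOnePlanar.exists_isConvexOnePlane {V : Type*} [Finite V] {G : SimpleGraph V}
    (hG : G.IsOuterOnePlanar) : ∃ _ : LinearOrder V, G.IsConvexOnePlane := by
  obtain ⟨D, hD1, hD2⟩ := hG
  obtain ⟨θ, hθ, h⟩ := D.exists_interleaved_arcs_meet hD1
  refine ⟨LinearOrder.lift' θ hθ, ?_⟩
  let _ : LinearOrder V := LinearOrder.lift' θ hθ
  have hlt : ∀ a b : V, a < b → θ a < θ b := fun a b hab => hab
  have key : ∀ a b c d : V, ∀ (hab : G.Adj a b) (hcd : G.Adj c d), Crosses a b c d →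
      ∃ p, ((⟨s(c, d), hcd⟩ : G.edgeSet), p) ∈ D.crossings ⟨s(a, b), hab⟩ := by
    intro a b c d hab hcd hc
    have hne : (⟨s(c, d), hcd⟩ : G.edgeSet) ≠ ⟨s(a, b), hab⟩ := by
      intro h
      replace h : s(c, d) = s(a, b) := congrArg Subtype.val h
      rw [Sym2.eq_iff] at h
      rcases hc with ⟨h1, h2, h3⟩ | ⟨h1, h2, h3⟩ <;> rcases h with ⟨rfl, rfl⟩ | ⟨rfl, rfl⟩ <;>
        order
    rcases hc with ⟨h1, h2, h3⟩ | ⟨h1, h2, h3⟩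
    · obtain ⟨p, hp⟩ := h ⟨s(a, b), hab⟩ ⟨s(c, d), hcd⟩ a b c d rfl rfl (hlt _ _ h1) (hlt _ _ h2)
        (hlt _ _ h3)
      exact ⟨p, hne, hp.1, hp.2⟩
    · obtain ⟨p, hp⟩ := h ⟨s(c, d), hcd⟩ ⟨s(a, b), hab⟩ c d a b rfl rfl (hlt _ _ h1) (hlt _ _ h2)
        (hlt _ _ h3)
      exact ⟨p, hne, hp.2, hp.1⟩
  intro a b c d c' d' hab hcd hcd' h1 h2
  obtain ⟨p, hp⟩ := key a b c d hab hcd h1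
  obtain ⟨p', hp'⟩ := key a b c' d' hab hcd' h2
  have : s(c, d) = s(c', d') := congrArg (fun q => (q.1 : Sym2 V)) (hD2 _ hp hp')
  rw [Sym2.eq_iff] at this
  rcases this with h3 | ⟨rfl, rfl⟩
  · exact h3
  · rcases h1 with ⟨h1, h1', h1''⟩ | ⟨h1, h1', h1''⟩ <;>
      rcases h2 with ⟨h2, h2', h2''⟩ | ⟨h2, h2', h2''⟩ <;> order

end SimpleGraph

end

/-! ### Partial colorings and gaps -/

section

open Set

namespace SimpleGraph

section PartialColoring

variable {V C : Type*} [Finite V] {G : SimpleGraph V} {L : V → Finset C} {c c' : V → C}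
  {T T' : Set V} {p q v x : V}

/-- The colors that appear on the neighbors of `v` in the colored set `T`. -/
noncomputable def seenColors (G : SimpleGraph V) (c : V → C) (T : Set V) (v : V) : Finset C :=
  (Set.toFinite (c '' {u | u ∈ T ∧ G.Adj v u})).toFinset

theorem mem_seenColors {k : C} : k ∈ seenColors G c T v ↔ ∃ u ∈ T, G.Adj v u ∧ c u = k := by
  simp [seenColors, and_assoc]

theorem seenColors_mono (h : EqOn c' c T) (hT : T ⊆ T') :
    seenColors G c T v ⊆ seenColors G c' T' v := by
  intro k hk
  obtain ⟨u, hu, hadj, rfl⟩ := mem_seenColors.1 hk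
  exact mem_seenColors.2 ⟨u, hT hu, hadj, h hu⟩

theorem seenColors_congr (h : EqOn c' c T) : seenColors G c' T v = seenColors G c T v :=
  (seenColors_mono h.symm Subset.rfl).antisymm (seenColors_mono h Subset.rfl)

open Classical in
/-- The colors that the next colored neighbor of `v` has to avoid: all colors seen by `v`, unless
there are already three of them. -/
noncomputable def pendingColors (G : SimpleGraph V) (c : V → C) (T : Set V) (v : V) : Finset C :=
  if (seenColors G c T v).card < 3 then seenColors G c T v else ∅

theorem pendingColors_subset : pendingColors G c T v ⊆ seenColors G c T v := by
  unfold pendingColors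
  split_ifs <;> simp

theorem card_pendingColors : (pendingColors G c T v).card ≤ 2 := by
  unfold pendingColors
  split_ifs with h
  · omega
  · simp

theorem pendingColors_eq_empty (h : 3 ≤ (seenColors G c T v).card) :
    pendingColors G c T v = ∅ := if_neg (not_lt.2 h)

theorem pendingColors_eq (h : (seenColors G c T v).card < 3) :
    pendingColors G c T v = seenColors G c T v := if_pos h

theorem pendingColors_congr (h : EqOn c' c T) :
    pendingColors G c' T v = pendingColors G c T v := by
  unfold pendingColors
  rw [seenColors_congr h]

/-- The colored neighbors of `v` satisfy the `3`-dynamic condition. -/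
def IsDynamicAt (G : SimpleGraph V) (c : V → C) (T : Set V) (v : V) : Prop :=
  min 3 {u | u ∈ T ∧ G.Adj v u}.ncard ≤ (seenColors G c T v).card

theorem IsDynamicAt.congr (hd : IsDynamicAt G c T v) (h : EqOn c' c T) : IsDynamicAt G c' T v := by
  unfold IsDynamicAt
  rwa [seenColors_congr h]

theorem IsDynamicAt.of_inter (hd : IsDynamicAt G c T v) (hT : T ⊆ T')
    (h : ∀ u ∈ T', G.Adj v u → u ∈ T) : IsDynamicAt G c T' v := by
  have : {u | u ∈ T' ∧ G.Adj v u} = {u | u ∈ T ∧ G.Adj v u} := by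
    ext u
    exact ⟨fun hu => ⟨h u hu.1 hu.2, hu.2⟩, fun hu => ⟨hT hu.1, hu.2⟩⟩
  unfold IsDynamicAt
  rw [this]
  exact hd.trans (Finset.card_le_card (seenColors_mono (eqOn_refl _ _) hT))

theorem IsDynamicAt.insert (hd : IsDynamicAt G c T v) (hT : T ⊆ T')
    (h : ∀ u ∈ T', G.Adj v u → u ∈ T ∨ u = x) (hx : G.Adj v x → c x ∉ pendingColors G c T v) :
    IsDynamicAt G c T' v := by
  classical
  by_cases hvx : G.Adj v x ∧ x ∈ T'
  swap
  · refine hd.of_inter hT fun u hu hadj => ?_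
    rcases h u hu hadj with h1 | rfl
    · exact h1
    · exact absurd ⟨hadj, hu⟩ hvx
  have hsub := seenColors_mono (G := G) (v := v) (eqOn_refl c T) hT
  unfold IsDynamicAt at hd ⊢
  rcases lt_or_ge (seenColors G c T v).card 3 with h3 | h3
  · have h4 : Insert.insert (c x) (seenColors G c T v) ⊆ seenColors G c T' v :=
      Finset.insert_subset (mem_seenColors.2 ⟨x, hvx.2, hvx.1, rfl⟩) hsub
    have h5 := Finset.card_le_card h4
    have h6 := hx hvx.1
    rw [pendingColors_eq h3] at h6
    rw [Finset.card_insert_of_notMem h6] at h5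
    have h7 : {u | u ∈ T' ∧ G.Adj v u} ⊆ Insert.insert x {u | u ∈ T ∧ G.Adj v u} := by
      rintro u ⟨hu, hadj⟩
      rcases h u hu hadj with h1 | h1
      · exact Or.inr ⟨h1, hadj⟩
      · exact Or.inl h1
    have h8 := (ncard_le_ncard h7 (toFinite _)).trans (ncard_insert_le _ _)
    omega
  · have := Finset.card_le_card hsub
    omega

theorem isDynamicAt_of_injOn (h : InjOn c {u | u ∈ T ∧ G.Adj v u}) : IsDynamicAt G c T v := by
  unfold IsDynamicAt seenColors
  rw [← ncard_eq_toFinset_card _ (toFinite _), h.ncard_image]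
  exact min_le_right _ _

/-- `c` is a `3`-dynamic list coloring of the subgraph induced by `T`. -/
structure IsPartialColoring (G : SimpleGraph V) (L : V → Finset C) (c : V → C) (T : Set V) :
    Prop where
  mem : ∀ v ∈ T, c v ∈ L v
  proper : ∀ u ∈ T, ∀ v ∈ T, G.Adj u v → c u ≠ c v
  dynamic : ∀ v ∈ T, IsDynamicAt G c T v

end PartialColoring

section Gap

variable {V C : Type*} [Finite V] [LinearOrder V] {G : SimpleGraph V} {L : V → Finset C}
  {c c' : V → C} {T T' : Set V} {p q x : V}

/-- The situation of the inductive coloring: `c` colors the set `T`, the open interval between the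
differently colored vertices `p` and `q` is uncolored, and edges from it lead only to `p`, `q` and
itself. -/
structure IsGap (G : SimpleGraph V) (L : V → Finset C) (c : V → C) (T : Set V) (p q : V) :
    Prop where
  good : IsPartialColoring G L c T
  lt : p < q
  left_mem : p ∈ T
  right_mem : q ∈ T
  empty : ∀ v ∈ T, p < v → v < q → False
  sep : ∀ v w, p < v → v < q → G.Adj v w → p ≤ w ∧ w ≤ q
  ne : c p ≠ c q

theorem IsGap.transfer (h : IsGap G L c T p q) (hc : EqOn c' c T) (hg : IsPartialColoring G L c' T')
    (hT : T ⊆ T') (he : ∀ v ∈ T', p < v → v < q → False) : IsGap G L c' T' p q where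
  good := hg
  lt := h.lt
  left_mem := hT h.left_mem
  right_mem := hT h.right_mem
  empty := he
  sep := h.sep
  ne := by
    rw [hc h.left_mem, hc h.right_mem]
    exact h.ne

/-- `x` is the last neighbor of `p` and the first neighbor of `q` between `p` and `q`. -/
structure IsPeak (G : SimpleGraph V) (p q x : V) : Prop where
  left_lt : p < x
  lt_right : x < q
  adj_left : G.Adj p x
  adj_right : G.Adj q x
  left_last : ∀ y, x < y → y < q → ¬ G.Adj p y
  right_first : ∀ y, p < y → y < x → ¬ G.Adj q y

open Classical in
/-- If there is a peak between `p` and `q`, then the colors that it has to avoid, those of `p` and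
`q` and their pending colors, are at most five. Without a peak nothing is required, since then no
single vertex has to avoid the pending colors of both ends. -/
def HasRoom (G : SimpleGraph V) (c : V → C) (T : Set V) (p q : V) : Prop :=
  ∀ x, IsPeak G p q x →
    ({c p, c q} ∪ pendingColors G c T p ∪ pendingColors G c T q).card ≤ 5

open Classical in
theorem hasRoom_of_card
    (h : ({c p, c q} ∪ pendingColors G c T p ∪ pendingColors G c T q).card ≤ 5) :
    HasRoom G c T p q := fun _ _ => h

theorem hasRoom_of_card_left (h : (pendingColors G c T p).card ≤ 1) : HasRoom G c T p q := by
  classical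
  refine hasRoom_of_card ?_
  have h1 := Finset.card_union_le ({c p, c q} ∪ pendingColors G c T p) (pendingColors G c T q)
  have h2 := Finset.card_union_le {c p, c q} (pendingColors G c T p)
  have h3 := Finset.card_le_two (a := c p) (b := c q)
  have h4 := card_pendingColors (G := G) (c := c) (T := T) (v := q)
  omega

/-- There is room if `p` sees a color `k` and `q` sees no color besides `k` and one other. -/
theorem hasRoom_of_shared_left {k b : C} (hk : k ∈ seenColors G c T p)
    (h : ∀ j ∈ seenColors G c T q, j = k ∨ j = b) : HasRoom G c T p q := by
  classical
  refine hasRoom_of_card ?_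
  rcases lt_or_ge (seenColors G c T p).card 3 with h3 | h3
  · rw [← pendingColors_eq h3] at hk
    have h1 : {c p, c q} ∪ pendingColors G c T p ∪ pendingColors G c T q ⊆
        {c p, c q, b} ∪ pendingColors G c T p := by
      intro j hj
      simp only [Finset.mem_union, Finset.mem_insert, Finset.mem_singleton] at hj ⊢
      rcases hj with (h1 | h1) | h1
      · tauto
      · exact Or.inr h1
      · rcases h j (pendingColors_subset h1) with rfl | rfl
        · exact Or.inr hk
        · simp
    have h2 := Finset.card_le_card h1
    have h4 := Finset.card_union_le {c p, c q, b} (pendingColors G c T p)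
    have h5 := Finset.card_le_three (a := c p) (b := c q) (c := b)
    have h6 := card_pendingColors (G := G) (c := c) (T := T) (v := p)
    omega
  · rw [pendingColors_eq_empty h3, Finset.union_empty]
    have h2 := Finset.card_union_le {c p, c q} (pendingColors G c T q)
    have h3 := Finset.card_le_two (a := c p) (b := c q)
    have h4 := card_pendingColors (G := G) (c := c) (T := T) (v := q)
    omega

/-- There is room if `q` sees a color `k` and `p` sees no color besides `k` and one other. -/
theorem hasRoom_of_shared_right {k b : C} (hk : k ∈ seenColors G c T q)
    (h : ∀ j ∈ seenColors G c T p, j = k ∨ j = b) : HasRoom G c T p q := by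
  classical
  refine hasRoom_of_card ?_
  rcases lt_or_ge (seenColors G c T q).card 3 with h3 | h3
  · rw [← pendingColors_eq h3] at hk
    have h1 : {c p, c q} ∪ pendingColors G c T p ∪ pendingColors G c T q ⊆
        {c p, c q, b} ∪ pendingColors G c T q := by
      intro j hj
      simp only [Finset.mem_union, Finset.mem_insert, Finset.mem_singleton] at hj ⊢
      rcases hj with (h1 | h1) | h1
      · tauto
      · rcases h j (pendingColors_subset h1) with rfl | rfl
        · exact Or.inr hk
        · simp
      · exact Or.inr h1
    have h2 := Finset.card_le_card h1
    have h4 := Finset.card_union_le {c p, c q, b} (pendingColors G c T q)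
    have h5 := Finset.card_le_three (a := c p) (b := c q) (c := b)
    have h6 := card_pendingColors (G := G) (c := c) (T := T) (v := q)
    omega
  · rw [pendingColors_eq_empty h3, Finset.union_empty]
    have h2 := Finset.card_union_le {c p, c q} (pendingColors G c T p)
    have h3 := Finset.card_le_two (a := c p) (b := c q)
    have h4 := card_pendingColors (G := G) (c := c) (T := T) (v := p)
    omega

theorem hasRoom_of_card_right (h : (pendingColors G c T q).card ≤ 1) : HasRoom G c T p q := by
  classical
  refine hasRoom_of_card ?_
  have h1 := Finset.card_union_le ({c p, c q} ∪ pendingColors G c T p) (pendingColors G c T q)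
  have h2 := Finset.card_union_le {c p, c q} (pendingColors G c T p)
  have h3 := Finset.card_le_two (a := c p) (b := c q)
  have h4 := card_pendingColors (G := G) (c := c) (T := T) (v := p)
  omega

/-- A gap below an edge has room: the color of `q` is pending at `p` unless nothing is, and vice
versa. -/
theorem hasRoom_of_adj (h : G.Adj p q) (hp : p ∈ T) (hq : q ∈ T) : HasRoom G c T p q := by
  classical
  refine hasRoom_of_card ?_
  have key : ∀ u w : V, w ∈ T → G.Adj u w → ((pendingColors G c T u).erase (c w)).card ≤ 1 := by
    intro u w hw huw
    rcases lt_or_ge (seenColors G c T u).card 3 with h3 | h3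
    · have : c w ∈ pendingColors G c T u := by
        rw [pendingColors_eq h3]
        exact mem_seenColors.2 ⟨w, hw, huw, rfl⟩
      rw [Finset.card_erase_of_mem this]
      have := card_pendingColors (G := G) (c := c) (T := T) (v := u)
      omega
    · simp [pendingColors_eq_empty h3]
  have h1 : {c p, c q} ∪ pendingColors G c T p ∪ pendingColors G c T q ⊆
      {c p, c q} ∪ (pendingColors G c T p).erase (c q) ∪
        (pendingColors G c T q).erase (c p) := by
    intro j
    simp only [Finset.mem_union, Finset.mem_insert, Finset.mem_singleton, Finset.mem_erase]
    tauto
  have h2 := Finset.card_le_card h1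
  have h3 := Finset.card_union_le ({c p, c q} ∪ (pendingColors G c T p).erase (c q))
    ((pendingColors G c T q).erase (c p))
  have h4 := Finset.card_union_le {c p, c q} ((pendingColors G c T p).erase (c q))
  have h5 := Finset.card_le_two (a := c p) (b := c q)
  have h6 := key p q hq h
  have h7 := key q p hp h.symm
  omega

/-- Every gap between `p` and `q` that has room can be colored, whatever the coloring outside. -/
def Fillable (G : SimpleGraph V) (L : V → Finset C) (p q : V) : Prop :=
  ∀ (c : V → C) (T : Set V), IsGap G L c T p q → HasRoom G c T p q →
    ∃ c', EqOn c' c T ∧ IsPartialColoring G L c' (T ∪ Ioo p q)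

/-- Coloring several vertices `W` of a gap. Apart from the `3`-dynamic condition at the two ends,
it suffices that the new vertices are colored properly, avoid the colors of `p` and `q`, and that
the new neighbors of each of them have different colors. -/
theorem IsGap.isPartialColoring_union (h : IsGap G L c T p q) {W : Set V} (hW : W ⊆ Ioo p q)
    (hc : EqOn c' c T) (hmem : ∀ v ∈ W, c' v ∈ L v)
    (hproper : ∀ v ∈ W, ∀ u ∈ W, G.Adj v u → c' v ≠ c' u)
    (hp : ∀ v ∈ W, c' v ≠ c p) (hq : ∀ v ∈ W, c' v ≠ c q)
    (hinj : ∀ v ∈ W, ∀ u ∈ W, ∀ w ∈ W, G.Adj v u → G.Adj v w → c' u = c' w → u = w)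
    (hdp : IsDynamicAt G c' (T ∪ W) p) (hdq : IsDynamicAt G c' (T ∪ W) q) :
    IsPartialColoring G L c' (T ∪ W) := by
  have hnbr : ∀ v ∈ W, ∀ u ∈ T, G.Adj v u → u = p ∨ u = q := by
    intro v hv u hu hadj
    have hv' := hW hv
    have h1 := h.sep v u hv'.1 hv'.2 hadj
    by_contra! hn
    exact h.empty u hu (lt_of_le_of_ne h1.1 hn.1.symm) (lt_of_le_of_ne h1.2 hn.2)
  have hcp := hc h.left_mem
  have hcq := hc h.right_mem
  have hWT : ∀ v ∈ W, ∀ u ∈ T, G.Adj v u → c' v ≠ c' u := by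
    intro v hv u hu hadj
    rcases hnbr v hv u hu hadj with rfl | rfl
    · rw [hcp]; exact hp v hv
    · rw [hcq]; exact hq v hv
  refine ⟨?_, ?_, ?_⟩
  · rintro v (hv | hv)
    · rw [hc hv]; exact h.good.mem v hv
    · exact hmem v hv
  · rintro u (hu | hu) v (hv | hv) hadj
    · rw [hc hu, hc hv]; exact h.good.proper u hu v hv hadj
    · exact (hWT v hv u hu hadj.symm).symm
    · exact hWT u hu v hv hadj
    · exact hproper u hu v hv hadj
  · rintro v (hv | hv)
    · by_cases hvW : ∃ u ∈ W, G.Adj v u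
      · obtain ⟨u, hu, hadj⟩ := hvW
        rcases hnbr u hu v hv hadj.symm with rfl | rfl
        · exact hdp
        · exact hdq
      · push Not at hvW
        refine ((h.good.dynamic v hv).congr hc).of_inter subset_union_left fun u hu hadj => ?_
        rcases hu with hu | hu
        · exact hu
        · exact absurd hadj (hvW u hu)
    · apply isDynamicAt_of_injOn
      rintro u ⟨hu, hvu⟩ w ⟨hw, hvw⟩ huw
      rcases hu with hu | hu <;> rcases hw with hw | hw
      · rcases hnbr v hv u hu hvu with rfl | rfl <;> rcases hnbr v hv w hw hvw with rfl | rfl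
        · rfl
        · rw [hcp, hcq] at huw; exact absurd huw h.ne
        · rw [hcp, hcq] at huw; exact absurd huw.symm h.ne
        · rfl
      · rcases hnbr v hv u hu hvu with rfl | rfl
        · rw [hcp] at huw; exact absurd huw.symm (hp w hw)
        · rw [hcq] at huw; exact absurd huw.symm (hq w hw)
      · rcases hnbr v hv w hw hvw with rfl | rfl
        · rw [hcp] at huw; exact absurd huw (hp u hu)
        · rw [hcq] at huw; exact absurd huw (hq u hu)
      · exact hinj v hv u hu w hw hvu hvw huw

/-- Coloring a single vertex of a gap. -/
theorem IsGap.exists_insert (h : IsGap G L c T p q) (hpx : p < x) (hxq : x < q) {k : C}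
    (hk : k ∈ L x) (hkp : k ≠ c p) (hkq : k ≠ c q) (hp : G.Adj p x → k ∉ pendingColors G c T p)
    (hq : G.Adj q x → k ∉ pendingColors G c T q) :
    ∃ c', EqOn c' c T ∧ c' x = k ∧ IsPartialColoring G L c' (T ∪ {x}) := by
  have hxT : x ∉ T := fun hx => h.empty x hx hpx hxq
  have hc : EqOn (Function.update c x k) c T := fun v hv =>
    Function.update_of_ne (by rintro rfl; exact hxT hv) _ _
  have hx : Function.update c x k x = k := Function.update_self _ _ _
  refine ⟨Function.update c x k, hc, hx, ?_⟩
  have hT : ∀ v, ∀ u ∈ T ∪ {x}, G.Adj v u → u ∈ T ∨ u = x := fun v u hu _ => hu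
  apply h.isPartialColoring_union (by simpa using ⟨hpx, hxq⟩) hc
  · rintro v rfl; rwa [hx]
  · rintro v rfl u rfl hadj; exact absurd hadj (G.irrefl)
  · rintro v rfl; rwa [hx]
  · rintro v rfl; rwa [hx]
  · rintro v rfl u rfl w rfl _ _ _; rfl
  · refine ((h.good.dynamic p h.left_mem).congr hc).insert subset_union_left (hT p) fun hadj => ?_
    rw [hx, pendingColors_congr hc]; exact hp hadj
  · refine ((h.good.dynamic q h.right_mem).congr hc).insert subset_union_left (hT q) fun hadj => ?_
    rw [hx, pendingColors_congr hc]; exact hq hadj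

/-- Two disjoint gaps are filled one after the other. The room in the second one is needed only
after the first one has been colored. -/
theorem IsGap.fill_two {p₁ q₁ p₂ q₂ : V} (h₁ : IsGap G L c T p₁ q₁) (h₂ : IsGap G L c T p₂ q₂)
    (hd : Disjoint (Ioo p₁ q₁) (Ioo p₂ q₂)) (f₁ : Fillable G L p₁ q₁) (f₂ : Fillable G L p₂ q₂)
    (r₁ : HasRoom G c T p₁ q₁)
    (r₂ : ∀ c', EqOn c' c T → HasRoom G c' (T ∪ Ioo p₁ q₁) p₂ q₂) :
    ∃ c', EqOn c' c T ∧ IsPartialColoring G L c' (T ∪ Ioo p₁ q₁ ∪ Ioo p₂ q₂) := by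
  obtain ⟨c₁, e₁, g₁⟩ := f₁ c T h₁ r₁
  have h₂' := h₂.transfer e₁ g₁ subset_union_left fun v hv h1 h2 => by
    rcases hv with hv | hv
    · exact h₂.empty v hv h1 h2
    · exact Set.disjoint_left.1 hd hv ⟨h1, h2⟩
  obtain ⟨c₂, e₂, g₂⟩ := f₂ c₁ _ h₂' (r₂ c₁ e₁)
  exact ⟨c₂, (e₂.mono subset_union_left).trans e₁, g₂⟩

theorem IsGap.fill_three {p₁ q₁ p₂ q₂ p₃ q₃ : V} (h₁ : IsGap G L c T p₁ q₁)
    (h₂ : IsGap G L c T p₂ q₂) (h₃ : IsGap G L c T p₃ q₃) (hd₁₂ : Disjoint (Ioo p₁ q₁) (Ioo p₂ q₂))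
    (hd₁₃ : Disjoint (Ioo p₁ q₁) (Ioo p₃ q₃)) (hd₂₃ : Disjoint (Ioo p₂ q₂) (Ioo p₃ q₃))
    (f₁ : Fillable G L p₁ q₁) (f₂ : Fillable G L p₂ q₂) (f₃ : Fillable G L p₃ q₃)
    (r₁ : HasRoom G c T p₁ q₁)
    (r₂ : ∀ c', EqOn c' c T → HasRoom G c' (T ∪ Ioo p₁ q₁) p₂ q₂)
    (r₃ : ∀ c', EqOn c' c T → HasRoom G c' (T ∪ Ioo p₁ q₁ ∪ Ioo p₂ q₂) p₃ q₃) :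
    ∃ c', EqOn c' c T ∧ IsPartialColoring G L c' (T ∪ Ioo p₁ q₁ ∪ Ioo p₂ q₂ ∪ Ioo p₃ q₃) := by
  obtain ⟨c₁, e₁, g₁⟩ := h₁.fill_two h₂ hd₁₂ f₁ f₂ r₁ r₂
  have h₃' := h₃.transfer e₁ g₁ (subset_union_left.trans subset_union_left) fun v hv h1 h2 => by
    rcases hv with (hv | hv) | hv
    · exact h₃.empty v hv h1 h2
    · exact Set.disjoint_left.1 hd₁₃ hv ⟨h1, h2⟩
    · exact Set.disjoint_left.1 hd₂₃ hv ⟨h1, h2⟩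
  obtain ⟨c₂, e₂, g₂⟩ := f₃ c₁ _ h₃' (r₃ c₁ e₁)
  exact ⟨c₂, (e₂.mono (subset_union_left.trans subset_union_left)).trans e₁, g₂⟩

/-- Gaps below edges can be filled independently of each other. -/
theorem IsPartialColoring.fill_edges (s : List (V × V)) :
    ∀ (c : V → C) (T : Set V), IsPartialColoring G L c T →
      (∀ e ∈ s, IsGap G L c T e.1 e.2 ∧ G.Adj e.1 e.2 ∧ Fillable G L e.1 e.2) →
      s.Pairwise (fun e f => Disjoint (Ioo e.1 e.2) (Ioo f.1 f.2)) →
      ∃ c', EqOn c' c T ∧ IsPartialColoring G L c' (T ∪ {v | ∃ e ∈ s, v ∈ Ioo e.1 e.2}) := by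
  induction s with
  | nil => exact fun c T hg _ _ => ⟨c, eqOn_refl _ _, by simpa using hg⟩
  | cons e s ih =>
    intro c T hg hs hd
    rw [List.pairwise_cons] at hd
    obtain ⟨h1, h2, h3⟩ := hs e (by simp)
    obtain ⟨c₁, e₁, g₁⟩ := h3 c T h1 (hasRoom_of_adj h2 h1.left_mem h1.right_mem)
    obtain ⟨c₂, e₂, g₂⟩ := ih c₁ _ g₁ (fun f hf => by
      obtain ⟨h1', h2', h3'⟩ := hs f (by simp [hf])
      refine ⟨h1'.transfer e₁ g₁ subset_union_left fun v hv h4 h5 => ?_, h2', h3'⟩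
      rcases hv with hv | hv
      · exact h1'.empty v hv h4 h5
      · exact Set.disjoint_left.1 (hd.1 f hf) hv ⟨h4, h5⟩) hd.2
    refine ⟨c₂, (e₂.mono subset_union_left).trans e₁, ?_⟩
    convert g₂ using 1
    ext v
    simp only [mem_union, mem_ofPred_eq, List.mem_cons, exists_eq_or_imp, or_assoc]

end Gap

end SimpleGraph

end

/-! ### Choosing colors and filling gaps without a crossing at both ends -/

section

open Set

namespace SimpleGraph

section Choice

variable {C : Type*}

/-- Colors `k` and `j` for the crossing ends `x` and `y` below `p` and `q`, which have colors `a`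
and `b` and pending colors `A` and `B`. The end that is adjacent to `p` avoids `A`, and the other
one has to avoid `A` as well only if a third color at `p` is still missing afterwards; likewise
for `q`. -/
theorem exists_two_colors {X Y A B : Finset C} (a b : C) (hX : 6 ≤ X.card) (hY : 6 ≤ Y.card)
    (hA : A.card ≤ 2) (hB : B.card ≤ 2) :
    ∃ k ∈ X, ∃ j ∈ Y, k ≠ j ∧ k ≠ a ∧ k ≠ b ∧ j ≠ a ∧ j ≠ b ∧ k ∉ A ∧ j ∉ B ∧
      (A.card ≤ 1 → j ∉ A) ∧ (B.card ≤ 1 → k ∉ B) := by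
  classical
  -- the vertex that has to avoid more pending colors is colored last
  have key : ∀ {X Y A B : Finset C}, 6 ≤ X.card → 6 ≤ Y.card → A.card ≤ 2 → B.card ≤ 2 →
      (2 ≤ A.card ∨ B.card ≤ 1) →
      ∃ k ∈ X, ∃ j ∈ Y, k ≠ j ∧ k ≠ a ∧ k ≠ b ∧ j ≠ a ∧ j ≠ b ∧ k ∉ A ∧ j ∉ B ∧
        (A.card ≤ 1 → j ∉ A) ∧ (B.card ≤ 1 → k ∉ B) := by
    intro X Y A B hX hY hA hB h
    have hp := Finset.card_le_two (a := a) (b := b)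
    obtain ⟨k, hk, hk'⟩ := Finset.exists_mem_notMem_of_card_lt_card (t := X)
      (s := {a, b} ∪ A ∪ (if B.card ≤ 1 then B else ∅)) (by
        have h1 := Finset.card_union_le ({a, b} ∪ A) (if B.card ≤ 1 then B else ∅)
        have h2 := Finset.card_union_le {a, b} A
        have h3 : (if B.card ≤ 1 then B else ∅).card ≤ 1 := by split_ifs <;> simp [*]
        omega)
    obtain ⟨j, hj, hj'⟩ := Finset.exists_mem_notMem_of_card_lt_card (t := Y)
      (s := {a, b, k} ∪ B ∪ (if A.card ≤ 1 then A else ∅)) (by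
        have h1 := Finset.card_union_le ({a, b, k} ∪ B) (if A.card ≤ 1 then A else ∅)
        have h2 := Finset.card_union_le {a, b, k} B
        have h3 : (if A.card ≤ 1 then A else ∅).card ≤ 1 := by split_ifs <;> simp [*]
        have h4 := Finset.card_le_three (a := a) (b := b) (c := k)
        have h5 : (if A.card ≤ 1 then A else ∅).card + B.card ≤ 2 := by
          split_ifs
          · omega
          · simpa using hB
        omega)
    simp only [Finset.mem_union, Finset.mem_insert, Finset.mem_singleton, not_or] at hk' hj'
    refine ⟨k, hk, j, hj, Ne.symm hj'.1.1.2.2, hk'.1.1.1, hk'.1.1.2, hj'.1.1.1, hj'.1.1.2.1,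
      hk'.1.2, hj'.1.2, fun h1 => ?_, fun h1 => ?_⟩
    · simpa [h1] using hj'.2
    · simpa [h1] using hk'.2
  by_cases h : 2 ≤ A.card ∨ B.card ≤ 1
  · exact key hX hY hA hB h
  · push Not at h
    obtain ⟨j, hj, k, hk, h1, h2, h3, h4, h5, h6, h7, h8, h9⟩ :=
      key hY hX hB hA (Or.inr (by omega))
    exact ⟨k, hk, j, hj, h1.symm, h4, h5, h2, h3, h7, h6, h9, h8⟩

/-- List coloring of the complete graph on `l`, `y`, `m`, `x`, `r` minus the edge `lr`. If the
lists of `l` and `r` share a color, it is used for both; otherwise only one of these two lists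
contains the color of `y`, and one of two choices for the color of `m` leaves a color in it. -/
theorem exists_five_colors {Λ Y M X R : Finset C} (hΛ : 3 ≤ Λ.card) (hY : 3 ≤ Y.card)
    (hM : 4 ≤ M.card) (hX : 3 ≤ X.card) (hR : 3 ≤ R.card) :
    ∃ l ∈ Λ, ∃ y ∈ Y, ∃ m ∈ M, ∃ x ∈ X, ∃ r ∈ R, y ≠ m ∧ y ≠ x ∧ m ≠ x ∧
      l ≠ y ∧ l ≠ m ∧ l ≠ x ∧ r ≠ y ∧ r ≠ m ∧ r ≠ x := by
  classical
  by_cases hΛR : ∃ t, t ∈ Λ ∧ t ∈ R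
  · obtain ⟨t, htl, htr⟩ := hΛR
    obtain ⟨y, hy, hy'⟩ := Finset.exists_mem_notMem_of_card_lt_card (s := {t}) (t := Y)
      (by simp; omega)
    obtain ⟨x, hx, hx'⟩ := Finset.exists_mem_notMem_of_card_lt_card (s := {t, y}) (t := X)
      (by have := Finset.card_le_two (a := t) (b := y); omega)
    obtain ⟨m, hm, hm'⟩ := Finset.exists_mem_notMem_of_card_lt_card (s := {t, y, x}) (t := M)
      (by have := Finset.card_le_three (a := t) (b := y) (c := x); omega)
    simp only [Finset.mem_insert, Finset.mem_singleton, not_or] at hy' hx' hm'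
    exact ⟨t, htl, y, hy, m, hm, x, hx, t, htr, Ne.symm hm'.2.1, Ne.symm hx'.2, hm'.2.2,
      Ne.symm hy', Ne.symm hm'.1, Ne.symm hx'.1, Ne.symm hy', Ne.symm hm'.1, Ne.symm hx'.1⟩
  · push Not at hΛR
    obtain ⟨y, hy⟩ : Y.Nonempty := Finset.card_pos.1 (by omega)
    obtain ⟨x, hx, hx'⟩ := Finset.exists_mem_notMem_of_card_lt_card (s := {y}) (t := X)
      (by simp; omega)
    obtain ⟨m, hm, hm'⟩ := Finset.exists_mem_notMem_of_card_lt_card (s := {y, x}) (t := M)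
      (by have := Finset.card_le_two (a := y) (b := x); omega)
    obtain ⟨n, hn, hn'⟩ := Finset.exists_mem_notMem_of_card_lt_card (s := {y, x, m}) (t := M)
      (by have := Finset.card_le_three (a := y) (b := x) (c := m); omega)
    simp only [Finset.mem_insert, Finset.mem_singleton, not_or] at hx' hm' hn'
    -- of the two candidates for `m`, one leaves a color for both `l` and `r`
    have hbad : ∀ S : Finset C, 3 ≤ S.card → ∀ i, (¬ ∃ l ∈ S, l ≠ y ∧ l ≠ i ∧ l ≠ x) →
        y ∈ S ∧ i ∈ S ∧ ∀ j ∈ S, j = y ∨ j = i ∨ j = x := by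
      intro S hS i hi
      have hsub : S ⊆ {y, i, x} := by
        intro j hj
        by_contra hj'
        simp only [Finset.mem_insert, Finset.mem_singleton, not_or] at hj'
        exact hi ⟨j, hj, hj'⟩
      have heq := Finset.eq_of_subset_of_card_le hsub (Finset.card_le_three.trans hS)
      rw [heq]
      simp
    have hgood : ∃ i ∈ M, i ≠ y ∧ i ≠ x ∧ (∃ l ∈ Λ, l ≠ y ∧ l ≠ i ∧ l ≠ x) ∧
        ∃ r ∈ R, r ≠ y ∧ r ≠ i ∧ r ≠ x := by
      by_contra! hno
      have h1 : ∀ i ∈ M, i ≠ y → i ≠ x →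
          (y ∈ Λ ∧ i ∈ Λ ∧ ∀ j ∈ Λ, j = y ∨ j = i ∨ j = x) ∨
          (y ∈ R ∧ i ∈ R ∧ ∀ j ∈ R, j = y ∨ j = i ∨ j = x) := by
        intro i hi hiy hix
        by_cases hl : ∃ l ∈ Λ, l ≠ y ∧ l ≠ i ∧ l ≠ x
        · right
          refine hbad R hR i ?_
          rintro ⟨r, hr, h2, h3, h4⟩
          exact h4 (hno i hi hiy hix hl r hr h2 h3)
        · exact Or.inl (hbad Λ hΛ i hl)
      rcases h1 m hm hm'.1 hm'.2 with h2 | h2 <;> rcases h1 n hn hn'.1 hn'.2.1 with h3 | h3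
      · rcases h2.2.2 n h3.2.1 with h | h | h
        · exact hn'.1 h
        · exact hn'.2.2 h
        · exact hn'.2.1 h
      · exact hΛR y h2.1 h3.1
      · exact hΛR y h3.1 h2.1
      · rcases h2.2.2 n h3.2.1 with h | h | h
        · exact hn'.1 h
        · exact hn'.2.2 h
        · exact hn'.2.1 h
    obtain ⟨i, hi, h1, h2, ⟨l, hl, h3, h4, h5⟩, r, hr, h6, h7, h8⟩ := hgood
    exact ⟨l, hl, y, hy, i, hi, x, hx, r, hr, h1.symm, Ne.symm hx', h2, h3, h4, h5, h6, h7, h8⟩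

end Choice

section Fill

variable {V C : Type*} [Finite V] {G : SimpleGraph V} {L : V → Finset C}
  {c c' : V → C} {T T' : Set V} {p q x y : V}

theorem card_pendingColors_le_one {k : C} (h : ∀ j ∈ seenColors G c T x, j = k) :
    (pendingColors G c T x).card ≤ 1 :=
  (Finset.card_le_card pendingColors_subset).trans <|
    Finset.card_le_one.2 fun a ha b hb => (h a ha).trans (h b hb).symm

theorem three_le_card_seenColors (h : 2 ≤ (seenColors G c T p).card) (hT : T ⊆ T') (hx : x ∈ T')
    (hadj : G.Adj p x) (hc : c x ∉ pendingColors G c T p) : 3 ≤ (seenColors G c T' p).card := by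
  classical
  have hsub := seenColors_mono (G := G) (v := p) (eqOn_refl c T) hT
  rcases lt_or_ge (seenColors G c T p).card 3 with h3 | h3
  · rw [pendingColors_eq h3] at hc
    have h5 := Finset.card_le_card
      (Finset.insert_subset (mem_seenColors.2 ⟨x, hx, hadj, rfl⟩) hsub)
    rw [Finset.card_insert_of_notMem hc] at h5
    omega
  · exact h3.trans (Finset.card_le_card hsub)

/-- Of two new neighbors of `p`, the second one need not avoid the pending colors if there are two
of them, as the first one already provides the third color. -/
theorem IsDynamicAt.insert_two (hd : IsDynamicAt G c T p) (hT : T ⊆ T')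
    (h : ∀ u ∈ T', G.Adj p u → u ∈ T ∨ u = x ∨ u = y) (hadj : G.Adj p x)
    (hx : c x ∉ pendingColors G c T p)
    (hy : (pendingColors G c T p).card ≤ 1 → c y ∉ pendingColors G c T p) (hyx : c y ≠ c x)
    (hxT : x ∈ T') : IsDynamicAt G c T' p := by
  have h1 : IsDynamicAt G c (T ∪ {x}) p :=
    hd.insert subset_union_left (fun u hu _ => hu) fun _ => hx
  refine h1.insert (x := y) (union_subset hT (by simpa using hxT)) (fun u hu hpu => ?_)
    fun _ hmem => ?_
  · rcases h u hu hpu with h2 | h2 | h2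
    · exact Or.inl (Or.inl h2)
    · exact Or.inl (Or.inr h2)
    · exact Or.inr h2
  · rcases le_or_gt 2 (seenColors G c T p).card with h2 | h2
    · have h3 := three_le_card_seenColors h2 (T' := T ∪ {x}) subset_union_left (Or.inr rfl) hadj hx
      rw [pendingColors_eq_empty h3] at hmem
      simp at hmem
    · obtain ⟨u, hu, hpu, hcu⟩ := mem_seenColors.1 (pendingColors_subset hmem)
      rcases hu with hu | rfl
      · have h3 : pendingColors G c T p = seenColors G c T p := pendingColors_eq (by omega)
        apply hy (by rw [h3]; omega)
        rw [h3, mem_seenColors]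
        exact ⟨u, hu, hpu, hcu⟩
      · exact hyx hcu.symm

variable [LinearOrder V]

theorem IsGap.eq_or_eq (h : IsGap G L c T p q) {v u : V} (hpv : p < v) (hvq : v < q) (hu : u ∈ T)
    (hadj : G.Adj v u) : u = p ∨ u = q := by
  have h1 := h.sep v u hpv hvq hadj
  by_contra! hn
  exact h.empty u hu (lt_of_le_of_ne h1.1 hn.1.symm) (lt_of_le_of_ne h1.2 hn.2)

theorem IsGap.sub (h : IsGap G L c T p q) {p' q' : V} {W : Set V}
    (hg : IsPartialColoring G L c' (T ∪ W)) (hp : p ≤ p') (hq : q' ≤ q) (hlt : p' < q')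
    (hp' : p' ∈ T ∪ W) (hq' : q' ∈ T ∪ W) (he : ∀ v ∈ W, p' < v → v < q' → False)
    (hs : ∀ v w, p' < v → v < q' → G.Adj v w → p' ≤ w ∧ w ≤ q') (hne : c' p' ≠ c' q') :
    IsGap G L c' (T ∪ W) p' q' where
  good := hg
  lt := hlt
  left_mem := hp'
  right_mem := hq'
  empty := by
    rintro v (hv | hv) h1 h2
    · exact h.empty v hv (hp.trans_lt h1) (h2.trans_le hq)
    · exact he v hv h1 h2
  sep := hs
  ne := hne

/-- The case that `p` has no neighbor in the gap: color the first vertex `x` of the gap and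
continue between `x` and `q`. -/
theorem IsGap.fill_of_forall_not_adj (hL : ∀ v, 6 ≤ (L v).card) (h : IsGap G L c T p q)
    (hf : ∀ x, p < x → x < q → Fillable G L x q) (hn : ∀ y, p < y → y < q → ¬ G.Adj p y) :
    ∃ c', EqOn c' c T ∧ IsPartialColoring G L c' (T ∪ Ioo p q) := by
  classical
  rcases (Ioo p q).eq_empty_or_nonempty with hemp | hne
  · exact ⟨c, eqOn_refl _ _, by rw [hemp, union_empty]; exact h.good⟩
  obtain ⟨x, ⟨hpx, hxq⟩, hmin⟩ := exists_min_image (Ioo p q) id (toFinite _) hne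
  simp only [mem_Ioo, id_eq, and_imp] at hmin
  obtain ⟨k, hk, hk'⟩ := Finset.exists_mem_notMem_of_card_lt_card (t := L x)
    (s := {c p, c q} ∪ pendingColors G c T q) (by
      have h1 := Finset.card_union_le {c p, c q} (pendingColors G c T q)
      have h2 := Finset.card_le_two (a := c p) (b := c q)
      have h3 := card_pendingColors (G := G) (c := c) (T := T) (v := q)
      have h4 := hL x
      omega)
  simp only [Finset.mem_union, Finset.mem_insert, Finset.mem_singleton, not_or] at hk'
  obtain ⟨c₁, e₁, hx, g₁⟩ := h.exists_insert hpx hxq hk hk'.1.1 hk'.1.2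
    (fun hadj => absurd hadj (hn x hpx hxq)) (fun _ => hk'.2)
  have hgap : IsGap G L c₁ (T ∪ {x}) x q := by
    refine h.sub g₁ hpx.le le_rfl hxq (Or.inr rfl) (Or.inl h.right_mem) ?_ ?_ ?_
    · rintro v rfl h1 h2; exact lt_irrefl _ h1
    · intro v w h1 h2 hvw
      have h3 := h.sep v w (hpx.trans h1) h2 hvw
      refine ⟨?_, h3.2⟩
      rcases h3.1.eq_or_lt with rfl | h4
      · exact absurd hvw.symm (hn v (hpx.trans h1) h2)
      · rcases h3.2.eq_or_lt with rfl | h5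
        · exact hxq.le
        · exact hmin w h4 h5
    · rw [hx, e₁ h.right_mem]; exact hk'.1.2
  obtain ⟨c₂, e₂, g₂⟩ := hf x hpx hxq c₁ _ hgap (by
    by_cases hadj : G.Adj x q
    · exact hasRoom_of_adj hadj hgap.left_mem hgap.right_mem
    · refine hasRoom_of_card_left (card_pendingColors_le_one (k := k) fun j hj => ?_)
      obtain ⟨u, hu, hxu, -⟩ := mem_seenColors.1 hj
      rcases hu with hu | rfl
      · rcases h.eq_or_eq hpx hxq hu hxu with rfl | rfl
        · exact absurd hxu.symm (hn x hpx hxq)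
        · exact absurd hxu hadj
      · exact absurd hxu G.irrefl)
  refine ⟨c₂, (e₂.mono subset_union_left).trans e₁, ?_⟩
  convert g₂ using 1
  ext v
  simp only [mem_union, mem_Ioo, mem_singleton_iff]
  grind

/-- The case that the edge from `p` to its last neighbor `x` in the gap is not crossed: color `x`,
and then fill the intervals on both sides of `x`. -/
theorem IsGap.fill_of_not_crossed (hL : ∀ v, 6 ≤ (L v).card) (h : IsGap G L c T p q)
    (hr : HasRoom G c T p q) (hpx : p < x) (hxq : x < q) (f₁ : Fillable G L p x)
    (f₂ : Fillable G L x q) (hadj : G.Adj p x) (hlast : ∀ y, x < y → y < q → ¬ G.Adj p y)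
    (hnc : ∀ y z, p < y → y < x → x < z → ¬ G.Adj y z) :
    ∃ c', EqOn c' c T ∧ IsPartialColoring G L c' (T ∪ Ioo p q) := by
  classical
  obtain ⟨k, hk, hk'⟩ := Finset.exists_mem_notMem_of_card_lt_card (t := L x)
    (s := {c p, c q} ∪ pendingColors G c T p ∪
      (if G.Adj q x then pendingColors G c T q else ∅)) (by
      have h4 := hL x
      split_ifs with hqx
      · have := hr x ⟨hpx, hxq, hadj, hqx, hlast, fun y h1 h2 h3 => hnc y q h1 h2 hxq h3.symm⟩
        refine lt_of_le_of_lt ?_ (show 5 < (L x).card by omega)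
        convert this
      · have h1 := Finset.card_union_le {c p, c q} (pendingColors G c T p)
        have h2 := Finset.card_le_two (a := c p) (b := c q)
        have h3 := card_pendingColors (G := G) (c := c) (T := T) (v := p)
        rw [Finset.union_empty]
        omega)
  simp only [Finset.mem_union, Finset.mem_insert, Finset.mem_singleton, not_or] at hk'
  obtain ⟨c₁, e₁, hx, g₁⟩ := h.exists_insert hpx hxq hk hk'.1.1.1 hk'.1.1.2
    (fun _ => hk'.1.2) (fun hqx => by simpa [hqx] using hk'.2)
  have gapR : IsGap G L c₁ (T ∪ {x}) x q := by
    refine h.sub g₁ hpx.le le_rfl hxq (Or.inr rfl) (Or.inl h.right_mem) ?_ ?_ ?_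
    · rintro v rfl h1 h2; exact lt_irrefl _ h1
    · intro v w h1 h2 hvw
      have h3 := h.sep v w (hpx.trans h1) h2 hvw
      refine ⟨?_, h3.2⟩
      by_contra! h4
      rcases h3.1.eq_or_lt with rfl | h5
      · exact hlast v h1 h2 hvw.symm
      · exact hnc w v h5 h4 h1 hvw.symm
    · rw [hx, e₁ h.right_mem]; exact hk'.1.1.2
  have gapL : IsGap G L c₁ (T ∪ {x}) p x := by
    refine h.sub g₁ le_rfl hxq.le hpx (Or.inl h.left_mem) (Or.inr rfl) ?_ ?_ ?_
    · rintro v rfl h1 h2; exact lt_irrefl _ h2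
    · intro v w h1 h2 hvw
      have h3 := h.sep v w h1 (h2.trans hxq) hvw
      refine ⟨h3.1, ?_⟩
      by_contra! h4
      exact hnc v w h1 h2 h4 hvw
    · rw [hx, e₁ h.left_mem]; exact Ne.symm hk'.1.1.1
  obtain ⟨c₂, e₂, g₂⟩ := gapR.fill_two gapL
    (Set.disjoint_left.2 fun v h1 h2 => lt_asymm h1.1 h2.2) f₂ f₁ (by
      by_cases hxq' : G.Adj x q
      · exact hasRoom_of_adj hxq' gapR.left_mem gapR.right_mem
      · refine hasRoom_of_card_left (card_pendingColors_le_one (k := c₁ p) fun j hj => ?_)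
        obtain ⟨u, hu, hxu, rfl⟩ := mem_seenColors.1 hj
        rcases hu with hu | rfl
        · rcases h.eq_or_eq hpx hxq hu hxu with rfl | rfl
          · rfl
          · exact absurd hxu hxq'
        · exact absurd hxu G.irrefl)
    (fun c' _ => hasRoom_of_adj hadj (Or.inl gapL.left_mem) (Or.inl gapL.right_mem))
  refine ⟨c₂, (e₂.mono subset_union_left).trans e₁, ?_⟩
  convert g₂ using 1
  ext v
  simp only [mem_union, mem_Ioo, mem_singleton_iff]
  grind

/-- The case that the edge from `p` to its last neighbor `x` in the gap is crossed by an edge `yz`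
with `z < q`: color `z`, and then fill the intervals on both sides of `z`. -/
theorem IsGap.fill_of_crossed {z : V} (H : G.IsConvexOnePlane) (hL : ∀ v, 6 ≤ (L v).card)
    (h : IsGap G L c T p q) (hpy : p < y) (hyx : y < x) (hxz : x < z) (hzq : z < q)
    (f₁ : Fillable G L p z) (f₂ : Fillable G L z q) (hadj : G.Adj p x) (hyz : G.Adj y z)
    (hlast : ∀ y, x < y → y < q → ¬ G.Adj p y) :
    ∃ c', EqOn c' c T ∧ IsPartialColoring G L c' (T ∪ Ioo p q) := by
  classical
  have hpz : p < z := hpy.trans (hyx.trans hxz)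
  have hpz' : ¬ G.Adj p z := hlast z hxz hzq
  -- an edge crossing `px` is `yz`, an edge crossing `yz` is `px`
  have c1 : ∀ v w, p < v → v < x → x < w → G.Adj v w → v = y ∧ w = z := fun v w h1 h2 h3 h4 =>
    H p x v w y z hadj h4 hyz (Or.inl ⟨h1, h2, h3⟩) (Or.inl ⟨hpy, hyx, hxz⟩)
  have c2 : ∀ v w, y < v → v < z → z < w → G.Adj v w → False := fun v w h1 h2 h3 h4 => by
    have := H y z v w p x hyz h4 hadj (Or.inl ⟨h1, h2, h3⟩) (Or.inr ⟨hpy, hyx, hxz⟩)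
    order
  obtain ⟨k, hk, hk'⟩ := Finset.exists_mem_notMem_of_card_lt_card (t := L z)
    (s := {c p, c q} ∪ pendingColors G c T q) (by
      have h1 := Finset.card_union_le {c p, c q} (pendingColors G c T q)
      have h2 := Finset.card_le_two (a := c p) (b := c q)
      have h3 := card_pendingColors (G := G) (c := c) (T := T) (v := q)
      have h4 := hL z
      omega)
  simp only [Finset.mem_union, Finset.mem_insert, Finset.mem_singleton, not_or] at hk'
  obtain ⟨c₁, e₁, hz, g₁⟩ := h.exists_insert hpz hzq hk hk'.1.1 hk'.1.2
    (fun hadj => absurd hadj hpz') (fun _ => hk'.2)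
  have hcross : ∀ v w, p < v → v < z → z < w → ¬ G.Adj v w := by
    intro v w h1 h2 h3 h4
    rcases lt_or_ge y v with h5 | h5
    · exact c2 v w h5 h2 h3 h4
    · have := c1 v w h1 (h5.trans_lt hyx) (hxz.trans h3) h4
      order
  have gapR : IsGap G L c₁ (T ∪ {z}) z q := by
    refine h.sub g₁ hpz.le le_rfl hzq (Or.inr rfl) (Or.inl h.right_mem) ?_ ?_ ?_
    · rintro v rfl h1 h2; exact lt_irrefl _ h1
    · intro v w h1 h2 hvw
      have h3 := h.sep v w (hpz.trans h1) h2 hvw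
      refine ⟨?_, h3.2⟩
      by_contra! h4
      rcases h3.1.eq_or_lt with rfl | h5
      · exact hlast v (hxz.trans h1) h2 hvw.symm
      · exact hcross w v h5 h4 h1 hvw.symm
    · rw [hz, e₁ h.right_mem]; exact hk'.1.2
  have gapL : IsGap G L c₁ (T ∪ {z}) p z := by
    refine h.sub g₁ le_rfl hzq.le hpz (Or.inl h.left_mem) (Or.inr rfl) ?_ ?_ ?_
    · rintro v rfl h1 h2; exact lt_irrefl _ h2
    · intro v w h1 h2 hvw
      have h3 := h.sep v w h1 (h2.trans hzq) hvw
      refine ⟨h3.1, ?_⟩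
      by_contra! h4
      exact hcross v w h1 h2 h4 hvw
    · rw [hz, e₁ h.left_mem]; exact Ne.symm hk'.1.1
  obtain ⟨c₂, e₂, g₂⟩ := gapR.fill_two gapL
    (Set.disjoint_left.2 fun v h1 h2 => lt_asymm h1.1 h2.2) f₂ f₁ (by
      by_cases hzq' : G.Adj z q
      · exact hasRoom_of_adj hzq' gapR.left_mem gapR.right_mem
      · refine hasRoom_of_card_left (card_pendingColors_le_one (k := c₁ p) fun j hj => ?_)
        obtain ⟨u, hu, hzu, rfl⟩ := mem_seenColors.1 hj
        rcases hu with hu | rfl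
        · rcases h.eq_or_eq hpz hzq hu hzu with rfl | rfl
          · rfl
          · exact absurd hzu hzq'
        · exact absurd hzu G.irrefl)
    -- there is no peak between `p` and `z`
    (fun c' _ u hu => by
      exfalso
      rcases lt_or_ge u x with h1 | h1
      · exact hu.left_last x h1 hxz hadj
      · exact hu.right_first y hpy (hyx.trans_le h1) hyz.symm)
  refine ⟨c₂, (e₂.mono subset_union_left).trans e₁, ?_⟩
  convert g₂ using 1
  ext v
  simp only [mem_union, mem_Ioo, mem_singleton_iff]
  grind

end Fill

end SimpleGraph

end

/-! ### Crossing edges from both ends of a gap -/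

section

open Set

namespace SimpleGraph

section Quadrilateral

variable {V C : Type*} [LinearOrder V] {G : SimpleGraph V} {L : V → Finset C}
  {c c' : V → C} {T T' : Set V} {p q x y : V}

/-- Two crossing edges `px` and `yq` below the vertices `p` and `q`, together with the consequence
that no other edge leaves one of the three intervals cut off by `x` and `y`. -/
structure IsCrossing (G : SimpleGraph V) (p y x q : V) : Prop where
  lt₁ : p < y
  lt₂ : y < x
  lt₃ : x < q
  adj_left : G.Adj p x
  adj_right : G.Adj y q
  nbr_left : ∀ w, G.Adj y w → p ≤ w ∧ w ≤ x ∨ w = q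
  nbr_right : ∀ w, G.Adj x w → y ≤ w ∧ w ≤ q ∨ w = p
  sep₁ : ∀ v w, p < v → v < y → G.Adj v w → p ≤ w ∧ w ≤ y
  sep₂ : ∀ v w, y < v → v < x → G.Adj v w → y ≤ w ∧ w ≤ x
  sep₃ : ∀ v w, x < v → v < q → G.Adj v w → x ≤ w ∧ w ≤ q

theorem IsConvexOnePlane.isCrossing (H : G.IsConvexOnePlane)
    (hs : ∀ v w, p < v → v < q → G.Adj v w → p ≤ w ∧ w ≤ q) (hpy : p < y) (hyx : y < x)
    (hxq : x < q) (hpx : G.Adj p x) (hyq : G.Adj y q) : IsCrossing G p y x q := by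
  have c1 : ∀ v w, p < v → v < x → x < w → G.Adj v w → v = y ∧ w = q := fun v w h1 h2 h3 h4 =>
    H p x v w y q hpx h4 hyq (Or.inl ⟨h1, h2, h3⟩) (Or.inl ⟨hpy, hyx, hxq⟩)
  have c2 : ∀ v w, v < y → y < w → w < q → G.Adj v w → v = p ∧ w = x := fun v w h1 h2 h3 h4 =>
    H y q v w p x hyq h4 hpx (Or.inr ⟨h1, h2, h3⟩) (Or.inr ⟨hpy, hyx, hxq⟩)
  refine ⟨hpy, hyx, hxq, hpx, hyq, ?_, ?_, ?_, ?_, ?_⟩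
  · intro w hw
    have h1 := hs y w hpy (hyx.trans hxq) hw
    rcases le_or_gt w x with h2 | h2
    · exact Or.inl ⟨h1.1, h2⟩
    · exact Or.inr (c1 y w hpy hyx h2 hw).2
  · intro w hw
    have h1 := hs x w (hpy.trans hyx) hxq hw
    rcases le_or_gt y w with h2 | h2
    · exact Or.inl ⟨h2, h1.2⟩
    · exact Or.inr (c2 w x h2 hyx hxq hw.symm).1
  · intro v w h1 h2 hw
    have h3 := hs v w h1 (h2.trans (hyx.trans hxq)) hw
    refine ⟨h3.1, ?_⟩
    by_contra! h4
    rcases h3.2.eq_or_lt with rfl | h5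
    · have := c1 v w h1 (h2.trans hyx) hxq hw
      order
    · have := c2 v w h2 h4 h5 hw
      order
  · intro v w h1 h2 hw
    have h3 := hs v w (hpy.trans h1) (h2.trans hxq) hw
    constructor
    · by_contra! h4
      have := c2 w v h4 h1 (h2.trans hxq) hw.symm
      order
    · by_contra! h4
      have := c1 v w (hpy.trans h1) h2 h4 hw
      order
  · intro v w h1 h2 hw
    have h3 := hs v w (hpy.trans (hyx.trans h1)) h2 hw
    refine ⟨?_, h3.2⟩
    by_contra! h4
    rcases h3.1.eq_or_lt with rfl | h5
    · have := c2 p v hpy (hyx.trans h1) h2 hw.symm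
      order
    · have := c1 w v h5 h4 h1 hw.symm
      order

/-- An edge between the two sides of a peak would cross both edges at the peak, so no edge leaves
the interval to the left of it. -/
theorem IsPeak.sep_left (H : G.IsConvexOnePlane) (h : IsPeak G p q x)
    (hs : ∀ v w, p < v → v < q → G.Adj v w → p ≤ w ∧ w ≤ q) :
    ∀ v w, p < v → v < x → G.Adj v w → p ≤ w ∧ w ≤ x := by
  intro v w h1 h2 hw
  have h3 := hs v w h1 (h2.trans h.lt_right) hw
  refine ⟨h3.1, ?_⟩
  by_contra! h4
  rcases h3.2.eq_or_lt with rfl | h5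
  · exact h.right_first v h1 h2 hw.symm
  · have := H v w p x x q hw h.adj_left h.adj_right.symm (Or.inr ⟨h1, h2, h4⟩)
      (Or.inl ⟨h2, h4, h5⟩)
    order

theorem IsPeak.sep_right (H : G.IsConvexOnePlane) (h : IsPeak G p q x)
    (hs : ∀ v w, p < v → v < q → G.Adj v w → p ≤ w ∧ w ≤ q) :
    ∀ v w, x < v → v < q → G.Adj v w → x ≤ w ∧ w ≤ q := by
  intro v w h1 h2 hw
  have h3 := hs v w (h.left_lt.trans h1) h2 hw
  refine ⟨?_, h3.2⟩
  by_contra! h4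
  rcases h3.1.eq_or_lt with rfl | h5
  · exact h.left_last v h1 h2 hw.symm
  · have := H w v p x x q hw.symm h.adj_left h.adj_right.symm (Or.inr ⟨h5, h4, h1⟩)
      (Or.inl ⟨h4, h1, h2⟩)
    order

variable [Finite V]

/-- The three intervals cut off by a crossing can be filled unless each of them lies below a
nonedge, has a peak, and the outer two have ends `p`, `q` that see fewer than two colors.
Otherwise one interval is safe, and it is filled last; the other two have room because its
vertices are still uncolored and therefore add no pending colors. -/
theorem IsGap.fill_crossing (hL : ∀ v, 6 ≤ (L v).card) (h : IsGap G L c T p q)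
    (hc : IsCrossing G p y x q) (f₁ : Fillable G L p y) (f₂ : Fillable G L y x)
    (f₃ : Fillable G L x q)
    (hsafe : (G.Adj p y ∨ (∀ l, ¬ IsPeak G p y l) ∨ 2 ≤ (seenColors G c T p).card) ∨
      (G.Adj x q ∨ (∀ r, ¬ IsPeak G x q r) ∨ 2 ≤ (seenColors G c T q).card) ∨
      (G.Adj y x ∨ ∀ m, ¬ IsPeak G y x m)) :
    ∃ c', EqOn c' c T ∧ IsPartialColoring G L c' (T ∪ Ioo p q) := by
  classical
  obtain ⟨hpy, hyx, hxq, hpx, hyq, nbry, nbrx, sep₁, sep₂, sep₃⟩ := hc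
  have hpx' := hpy.trans hyx
  have hyq' := hyx.trans hxq
  have hxT : x ∉ T := fun hx => h.empty x hx hpx' hxq
  have hyT : y ∉ T := fun hy => h.empty y hy hpy hyq'
  obtain ⟨kx, hkx, ky, hky, n1, n2, n3, n4, n5, n6, n7, n8, n9⟩ := exists_two_colors (c p) (c q)
    (hL x) (hL y) (card_pendingColors (G := G) (c := c) (T := T) (v := p))
    (card_pendingColors (G := G) (c := c) (T := T) (v := q))
  obtain ⟨d, hd, hdx, hdy⟩ : ∃ d : V → C, EqOn d c T ∧ d x = kx ∧ d y = ky := by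
    refine ⟨Function.update (Function.update c x kx) y ky, fun v hv => ?_, ?_, ?_⟩
    · rw [Function.update_of_ne (by rintro rfl; exact hyT hv),
        Function.update_of_ne (by rintro rfl; exact hxT hv)]
    · rw [Function.update_of_ne hyx.ne', Function.update_self]
    · rw [Function.update_self]
  have hdp := hd h.left_mem
  have hdq := hd h.right_mem
  rw [← hdx] at hkx n1 n2 n3 n6 n9
  rw [← hdy] at hky n1 n4 n5 n7 n8
  rw [← hdp] at n2 n4
  rw [← hdq] at n3 n5
  have hpq : d p ≠ d q := by rw [hdp, hdq]; exact h.ne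
  rw [← pendingColors_congr hd] at n6 n7 n8 n9
  set S : Set V := T ∪ {x, y} with hS
  have hTS : T ⊆ S := subset_union_left
  have hxS : x ∈ S := Or.inr (Or.inl rfl)
  have hyS : y ∈ S := Or.inr (Or.inr rfl)
  have hpS : p ∈ S := hTS h.left_mem
  have hqS : q ∈ S := hTS h.right_mem
  have hSmem : ∀ v ∈ S, p < v → v < q → v = x ∨ v = y := by
    rintro v (hv | hv) h1 h2
    · exact (h.empty v hv h1 h2).elim
    · exact hv
  have good : IsPartialColoring G L d S := by
    apply h.isPartialColoring_union (W := {x, y}) _ hd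
    · rintro v (rfl | rfl) <;> assumption
    · rintro v (rfl | rfl) u (rfl | rfl) hvu
      · exact absurd hvu G.irrefl
      · exact n1
      · exact n1.symm
      · exact absurd hvu G.irrefl
    · rw [← hdp]; rintro v (rfl | rfl) <;> assumption
    · rw [← hdq]; rintro v (rfl | rfl) <;> assumption
    · rintro v - u (rfl | rfl) w (rfl | rfl) - - huw
      · rfl
      · exact absurd huw n1
      · exact absurd huw.symm n1
      · rfl
    · refine ((h.good.dynamic p h.left_mem).congr hd).insert_two hTS (fun u hu _ => hu) hpx n6 n8
        n1.symm hxS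
    · exact ((h.good.dynamic q h.right_mem).congr hd).insert_two hTS
        (fun u hu _ => hu.imp_right Or.symm) hyq.symm n7 n9 n1 hyS
    · rintro v (rfl | rfl)
      · exact ⟨hpx', hxq⟩
      · exact ⟨hpy, hyq'⟩
  have gap₁ : IsGap G L d S p y := by
    refine h.sub good le_rfl hyq'.le hpy hpS hyS ?_ sep₁ n4.symm
    rintro v (rfl | rfl) h1 h2 <;> order
  have gap₂ : IsGap G L d S y x := by
    refine h.sub good hpy.le hxq.le hyx hyS hxS ?_ sep₂ n1.symm
    rintro v (rfl | rfl) h1 h2 <;> order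
  have gap₃ : IsGap G L d S x q := by
    refine h.sub good hpx'.le le_rfl hxq hxS hqS ?_ sep₃ n3
    rintro v (rfl | rfl) h1 h2 <;> order
  have dis₁₂ : Disjoint (Ioo p y) (Ioo y x) :=
    Set.disjoint_left.2 fun v h1 h2 => lt_asymm h1.2 h2.1
  have dis₁₃ : Disjoint (Ioo p y) (Ioo x q) :=
    Set.disjoint_left.2 fun v h1 h2 => lt_asymm (h1.2.trans hyx) h2.1
  have dis₂₃ : Disjoint (Ioo y x) (Ioo x q) :=
    Set.disjoint_left.2 fun v h1 h2 => lt_asymm h1.2 h2.1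
  have hend : ∀ {d'} {S'}, EqOn d' d S → IsPartialColoring G L d' S' →
      (∀ v, v ∈ S' ↔ v ∈ S ∨ p < v ∧ v < y ∨ y < v ∧ v < x ∨ x < v ∧ v < q) →
      ∃ c', EqOn c' c T ∧ IsPartialColoring G L c' (T ∪ Ioo p q) := by
    intro d' S' he hg hS'
    refine ⟨d', (he.mono hTS).trans hd, ?_⟩
    convert hg using 1
    ext v
    simp only [hS', hS, mem_union, mem_Ioo, mem_insert_iff, mem_singleton_iff]
    grind
  -- the outer intervals have room as long as the middle one is uncolored
  have room₁ : ∀ (d' : V → C) (S' : Set V), S ⊆ S' → (∀ u ∈ S', p < u → u < x → u = y) →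
      HasRoom G d' S' p y := by
    intro d' S' hS' hm
    by_cases hadj : G.Adj p y
    · exact hasRoom_of_adj hadj (hS' hpS) (hS' hyS)
    refine hasRoom_of_shared_left (k := d' x) (b := d' q)
      (mem_seenColors.2 ⟨x, hS' hxS, hpx, rfl⟩) fun j hj => ?_
    obtain ⟨u, hu, hyu, rfl⟩ := mem_seenColors.1 hj
    rcases nbry u hyu with ⟨h1, h2⟩ | rfl
    · rcases h1.eq_or_lt with rfl | h1
      · exact absurd hyu.symm hadj
      rcases h2.eq_or_lt with rfl | h2
      · exact Or.inl rfl
      · exact absurd hyu (hm u hu h1 h2 ▸ G.irrefl)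
    · exact Or.inr rfl
  have room₃ : ∀ (d' : V → C) (S' : Set V), S ⊆ S' → (∀ u ∈ S', y < u → u < q → u = x) →
      HasRoom G d' S' x q := by
    intro d' S' hS' hm
    by_cases hadj : G.Adj x q
    · exact hasRoom_of_adj hadj (hS' hxS) (hS' hqS)
    refine hasRoom_of_shared_right (k := d' y) (b := d' p)
      (mem_seenColors.2 ⟨y, hS' hyS, hyq.symm, rfl⟩) fun j hj => ?_
    obtain ⟨u, hu, hxu, rfl⟩ := mem_seenColors.1 hj
    rcases nbrx u hxu with ⟨h1, h2⟩ | rfl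
    · rcases h2.eq_or_lt with rfl | h2
      · exact absurd hxu hadj
      rcases h1.eq_or_lt with rfl | h1
      · exact Or.inl rfl
      · exact absurd hxu (hm u hu h1 h2 ▸ G.irrefl)
    · exact Or.inr rfl
  -- the middle interval has room as long as one of the outer ones is uncolored
  have room₂ : ∀ (d' : V → C) (S' : Set V), S ⊆ S' →
      ((∀ u ∈ S', p < u → u < x → u = y) ∨ (∀ u ∈ S', y < u → u < q → u = x)) →
      HasRoom G d' S' y x := by
    intro d' S' hS' hm
    by_cases hadj : G.Adj y x
    · exact hasRoom_of_adj hadj (hS' hyS) (hS' hxS)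
    rcases hm with hm | hm
    · refine hasRoom_of_shared_right (k := d' p) (b := d' q)
        (mem_seenColors.2 ⟨p, hS' hpS, hpx.symm, rfl⟩) fun j hj => ?_
      obtain ⟨u, hu, hyu, rfl⟩ := mem_seenColors.1 hj
      rcases nbry u hyu with ⟨h1, h2⟩ | rfl
      · rcases h1.eq_or_lt with rfl | h1
        · exact Or.inl rfl
        rcases h2.eq_or_lt with rfl | h2
        · exact absurd hyu hadj
        · exact absurd hyu (hm u hu h1 h2 ▸ G.irrefl)
      · exact Or.inr rfl
    · refine hasRoom_of_shared_left (k := d' q) (b := d' p)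
        (mem_seenColors.2 ⟨q, hS' hqS, hyq, rfl⟩) fun j hj => ?_
      obtain ⟨u, hu, hxu, rfl⟩ := mem_seenColors.1 hj
      rcases nbrx u hxu with ⟨h1, h2⟩ | rfl
      · rcases h2.eq_or_lt with rfl | h2
        · exact Or.inl rfl
        rcases h1.eq_or_lt with rfl | h1
        · exact absurd hxu.symm hadj
        · exact absurd hxu (hm u hu h1 h2 ▸ G.irrefl)
      · exact Or.inr rfl
  -- a safe interval is filled last
  rcases hsafe with hsafe | hsafe | hsafe
  · obtain ⟨d', he, hg⟩ := gap₃.fill_three gap₂ gap₁ dis₂₃.symm dis₁₃.symm dis₁₂.symm f₃ f₂ f₁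
      (room₃ d S Subset.rfl fun u hu h1 h2 => by
        rcases hSmem u hu (hpy.trans h1) h2 with rfl | rfl
        · rfl
        · order)
      (fun d' _ => room₂ d' _ subset_union_left (Or.inl fun u hu h1 h2 => by
        rcases hu with hu | hu
        · rcases hSmem u hu h1 (h2.trans hxq) with rfl | rfl
          · order
          · rfl
        · exact absurd hu.1 h2.not_gt))
      (fun d' he => by
        rcases hsafe with hadj | hnp | h2
        · exact hasRoom_of_adj hadj (Or.inl (Or.inl hpS)) (Or.inl (Or.inl hyS))
        · exact fun l hl => absurd hl (hnp l)
        · rw [← seenColors_congr hd] at h2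
          have h3 := three_le_card_seenColors h2 hTS hxS hpx n6
          have h4 := Finset.card_le_card (seenColors_mono (G := G) (v := p) he
            (T' := S ∪ Ioo x q ∪ Ioo y x) (subset_union_left.trans subset_union_left))
          refine hasRoom_of_card_left ?_
          rw [pendingColors_eq_empty (h3.trans h4)]
          simp)
    refine hend he hg fun v => ?_
    simp only [mem_union, mem_Ioo]
    grind
  · obtain ⟨d', he, hg⟩ := gap₁.fill_three gap₂ gap₃ dis₁₂ dis₁₃ dis₂₃ f₁ f₂ f₃
      (room₁ d S Subset.rfl fun u hu h1 h2 => by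
        rcases hSmem u hu h1 (h2.trans hxq) with rfl | rfl
        · order
        · rfl)
      (fun d' _ => room₂ d' _ subset_union_left (Or.inr fun u hu h1 h2 => by
        rcases hu with hu | hu
        · rcases hSmem u hu (hpy.trans h1) h2 with rfl | rfl
          · rfl
          · order
        · exact absurd hu.2 h1.not_gt))
      (fun d' he => by
        rcases hsafe with hadj | hnp | h2
        · exact hasRoom_of_adj hadj (Or.inl (Or.inl hxS)) (Or.inl (Or.inl hqS))
        · exact fun l hl => absurd hl (hnp l)
        · rw [← seenColors_congr hd] at h2
          have h3 := three_le_card_seenColors h2 hTS hyS hyq.symm n7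
          have h4 := Finset.card_le_card (seenColors_mono (G := G) (v := q) he
            (T' := S ∪ Ioo p y ∪ Ioo y x) (subset_union_left.trans subset_union_left))
          refine hasRoom_of_card_right ?_
          rw [pendingColors_eq_empty (h3.trans h4)]
          simp)
    refine hend he hg fun v => ?_
    simp only [mem_union, mem_Ioo]
    grind
  · obtain ⟨d', he, hg⟩ := gap₁.fill_three gap₃ gap₂ dis₁₃ dis₁₂ dis₂₃.symm f₁ f₃ f₂
      (room₁ d S Subset.rfl fun u hu h1 h2 => by
        rcases hSmem u hu h1 (h2.trans hxq) with rfl | rfl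
        · order
        · rfl)
      (fun d' _ => room₃ d' _ subset_union_left fun u hu h1 h2 => by
        rcases hu with hu | hu
        · rcases hSmem u hu (hpy.trans h1) h2 with rfl | rfl
          · rfl
          · order
        · exact absurd hu.2 h1.not_gt)
      (fun d' he => by
        rcases hsafe with hadj | hnp
        · exact hasRoom_of_adj hadj (Or.inl (Or.inl hyS)) (Or.inl (Or.inl hxS))
        · exact fun l hl => absurd hl (hnp l))
    refine hend he hg fun v => ?_
    simp only [mem_union, mem_Ioo]
    grind

/-- Five points of an open interval cut it into six open intervals. -/
theorem lt_and_lt_iff_of_chain {α : Type*} [LinearOrder α] {p l y m x r q v : α} (h₁ : p < l)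
    (h₂ : l < y) (h₃ : y < m) (h₄ : m < x) (h₅ : x < r) (h₆ : r < q) :
    p < v ∧ v < q ↔ (v = l ∨ v = y ∨ v = m ∨ v = x ∨ v = r) ∨ p < v ∧ v < l ∨ l < v ∧ v < y ∨
      y < v ∧ v < m ∨ m < v ∧ v < x ∨ x < v ∧ v < r ∨ r < v ∧ v < q := by
  have split : ∀ {a b c : α}, a < b → b < c → (a < v ∧ v < c ↔ v = b ∨ a < v ∧ v < b ∨
      b < v ∧ v < c) := by
    intro a b c hab hbc
    grind
  rw [split (h₁.trans h₂) (h₃.trans (h₄.trans (h₅.trans h₆))), split h₁ h₂,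
    split (h₃.trans h₄) (h₅.trans h₆), split h₃ h₄, split h₅ h₆]
  exact Iff.of_eq (by ac_rfl)

set_option maxHeartbeats 1000000 in
/-- The critical configuration: the three intervals cut off by the crossing edges have peaks, and
the five new vertices have to be colored simultaneously. All remaining gaps lie below edges. -/
theorem IsGap.fill_crossing_of_isPeak {l m r : V} (H : G.IsConvexOnePlane)
    (hL : ∀ v, 6 ≤ (L v).card) (h : IsGap G L c T p q) (hc : IsCrossing G p y x q)
    (hpl : IsPeak G p y l) (hpm : IsPeak G y x m) (hpr : IsPeak G x q r)
    (npy : ¬ G.Adj p y) (nyx : ¬ G.Adj y x) (nxq : ¬ G.Adj x q)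
    (sp : (seenColors G c T p).card ≤ 1) (sq : (seenColors G c T q).card ≤ 1)
    (hf : ∀ p' q', p ≤ p' → q' ≤ q → p < p' ∨ q' < q → Fillable G L p' q') :
    ∃ c', EqOn c' c T ∧ IsPartialColoring G L c' (T ∪ Ioo p q) := by
  classical
  obtain ⟨hpy, hyx, hxq, hpx, hyq, nbry, nbrx, sep₁, sep₂, sep₃⟩ := hc
  have l1 := hpl.left_lt
  have l2 := hpl.lt_right
  have l3 := hpm.left_lt
  have l4 := hpm.lt_right
  have l5 := hpr.left_lt
  have l6 := hpr.lt_right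
  set A := pendingColors G c T p with hA
  set B := pendingColors G c T q with hB
  have cA : A.card ≤ 1 := (Finset.card_le_card pendingColors_subset).trans sp
  have cB : B.card ≤ 1 := (Finset.card_le_card pendingColors_subset).trans sq
  have hab := Finset.card_le_two (a := c p) (b := c q)
  have hbig : ∀ (v : V) (F : Finset C), F.card ≤ 1 →
      3 ≤ (L v \ ({c p, c q} ∪ F)).card := by
    intro v F hF
    have h1 := Finset.le_card_sdiff ({c p, c q} ∪ F) (L v)
    have h2 := Finset.card_union_le {c p, c q} F
    have h3 := hL v
    omega
  have hbig' : 4 ≤ (L m \ {c p, c q}).card := by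
    have h1 := Finset.le_card_sdiff {c p, c q} (L m)
    have h3 := hL m
    omega
  obtain ⟨kl, hkl, ky, hky, km, hkm, kx, hkx, kr, hkr, nym, nyx', nmx, nly, nlm, nlx, nry, nrm,
    nrx⟩ := exists_five_colors (hbig l A cA) (hbig y B cB) hbig' (hbig x A cA) (hbig r B cB)
  simp only [Finset.mem_sdiff, Finset.mem_union, Finset.mem_insert, Finset.mem_singleton,
    not_or] at hkl hky hkm hkx hkr
  have hT : ∀ v ∈ T, p < v → v < q → False := h.empty
  obtain ⟨d, hd, dl, dy, dm, dx, dr⟩ : ∃ d : V → C, EqOn d c T ∧ d l = kl ∧ d y = ky ∧ d m = km ∧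
      d x = kx ∧ d r = kr := by
    refine ⟨fun v => if v = l then kl else if v = y then ky else if v = m then km else
      if v = x then kx else if v = r then kr else c v, fun v hv => ?_, ?_, ?_, ?_, ?_, ?_⟩
    · have := hT v hv
      have h1 : v ≠ l := by rintro rfl; exact this (by order) (by order)
      have h2 : v ≠ y := by rintro rfl; exact this (by order) (by order)
      have h3 : v ≠ m := by rintro rfl; exact this (by order) (by order)
      have h4 : v ≠ x := by rintro rfl; exact this (by order) (by order)
      have h5 : v ≠ r := by rintro rfl; exact this (by order) (by order)
      simp [h1, h2, h3, h4, h5]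
    · simp
    · simp [l2.ne']
    · simp [l3.ne', (l2.trans l3).ne']
    · simp [l4.ne', hyx.ne', (l2.trans hyx).ne']
    · simp [l5.ne', (l4.trans l5).ne', (hyx.trans l5).ne', (l2.trans (hyx.trans l5)).ne']
  subst dl dy dm dx dr
  have hdp := hd h.left_mem
  have hdq := hd h.right_mem
  rw [← hdp, ← hdq] at hkl hky hkm hkx hkr
  rw [← pendingColors_congr hd] at hA hB
  set W : Set V := {l, y, m, x, r} with hW
  have hWmem : ∀ {v}, v ∈ W ↔ v = l ∨ v = y ∨ v = m ∨ v = x ∨ v = r := by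
    intro v; simp [hW]
  have hTW : T ⊆ T ∪ W := subset_union_left
  have hpT : p ∈ T ∪ W := hTW h.left_mem
  have hqT : q ∈ T ∪ W := hTW h.right_mem
  have mem_l : l ∈ T ∪ W := Or.inr (hWmem.2 (by simp))
  have mem_y : y ∈ T ∪ W := Or.inr (hWmem.2 (by simp))
  have mem_m : m ∈ T ∪ W := Or.inr (hWmem.2 (by simp))
  have mem_x : x ∈ T ∪ W := Or.inr (hWmem.2 (by simp))
  have mem_r : r ∈ T ∪ W := Or.inr (hWmem.2 (by simp))
  -- neighbors of the new vertices
  have nbrl := sep₁ l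
  have nbrm := sep₂ m
  have nbrr := sep₃ r
  have hinj : ∀ u ∈ W, ∀ w ∈ W, d u = d w → u = w ∨ u = l ∧ w = r ∨ u = r ∧ w = l := by
    intro u hu w hw huw
    rcases hWmem.1 hu with rfl | rfl | rfl | rfl | rfl <;>
      rcases hWmem.1 hw with rfl | rfl | rfl | rfl | rfl <;>
      first
      | exact Or.inl rfl
      | exact Or.inr (Or.inl ⟨rfl, rfl⟩)
      | exact Or.inr (Or.inr ⟨rfl, rfl⟩)
      | exact absurd huw (by assumption)
      | exact absurd huw.symm (by assumption)
  have good : IsPartialColoring G L d (T ∪ W) := by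
    apply h.isPartialColoring_union (W := W) _ hd
    · intro v hv
      rcases hWmem.1 hv with rfl | rfl | rfl | rfl | rfl
      exacts [hkl.1, hky.1, hkm.1, hkx.1, hkr.1]
    · intro v hv u hu hvu hcol
      rcases hinj v hv u hu hcol with rfl | ⟨rfl, rfl⟩ | ⟨rfl, rfl⟩
      · exact G.irrefl hvu
      · exact absurd (nbrl _ l1 l2 hvu).2 (by order)
      · exact absurd (nbrl _ l1 l2 hvu.symm).2 (by order)
    · rw [← hdp]
      intro v hv
      rcases hWmem.1 hv with rfl | rfl | rfl | rfl | rfl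
      exacts [hkl.2.1.1, hky.2.1.1, hkm.2.1, hkx.2.1.1, hkr.2.1.1]
    · rw [← hdq]
      intro v hv
      rcases hWmem.1 hv with rfl | rfl | rfl | rfl | rfl
      exacts [hkl.2.1.2, hky.2.1.2, hkm.2.2, hkx.2.1.2, hkr.2.1.2]
    · -- no vertex is adjacent to both `l` and `r`
      intro v _ u hu w hw hvu hvw hcol
      rcases hinj u hu w hw hcol with h1 | ⟨rfl, rfl⟩ | ⟨rfl, rfl⟩
      · exact h1
      · have h1 := (nbrl v l1 l2 hvu.symm).2
        have h2 := (nbrr v l5 l6 hvw.symm).1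
        order
      · have h1 := (nbrl v l1 l2 hvw.symm).2
        have h2 := (nbrr v l5 l6 hvu.symm).1
        order
    · refine ((h.good.dynamic p h.left_mem).congr hd).insert_two (x := x) (y := l) hTW ?_ hpx ?_ ?_
        nlx mem_x
      · rintro u (hu | hu) hpu
        · exact Or.inl hu
        · rcases hWmem.1 hu with rfl | rfl | rfl | rfl | rfl
          · exact Or.inr (Or.inr rfl)
          · exact absurd hpu npy
          · exact absurd (nbrm p l3 l4 hpu.symm).1 (by order)
          · exact Or.inr (Or.inl rfl)
          · exact absurd (nbrr p l5 l6 hpu.symm).1 (by order)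
      · rw [← hA]; exact hkx.2.2
      · rw [← hA]; exact fun _ => hkl.2.2
    · refine ((h.good.dynamic q h.right_mem).congr hd).insert_two (x := y) (y := r) hTW ?_ hyq.symm
        ?_ ?_ nry mem_y
      · rintro u (hu | hu) hqu
        · exact Or.inl hu
        · rcases hWmem.1 hu with rfl | rfl | rfl | rfl | rfl
          · exact absurd (nbrl q l1 l2 hqu.symm).2 (by order)
          · exact Or.inr (Or.inl rfl)
          · exact absurd (nbrm q l3 l4 hqu.symm).2 (by order)
          · exact absurd hqu.symm nxq
          · exact Or.inr (Or.inr rfl)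
      · rw [← hB]; exact hky.2.2
      · rw [← hB]; exact fun _ => hkr.2.2
    · intro v hv
      rcases hWmem.1 hv with rfl | rfl | rfl | rfl | rfl <;> constructor <;> order
  have gap : ∀ p' q', p ≤ p' → q' ≤ q → p' < q' → p' ∈ T ∪ W → q' ∈ T ∪ W →
      (∀ v ∈ W, p' < v → v < q' → False) →
      (∀ v w, p' < v → v < q' → G.Adj v w → p' ≤ w ∧ w ≤ q') → d p' ≠ d q' →
      IsGap G L d (T ∪ W) p' q' := fun p' q' h1 h2 h3 h4 h5 h6 h7 h8 =>
    h.sub good h1 h2 h3 h4 h5 h6 h7 h8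
  have hemp : ∀ {p' q' : V}, (l ≤ p' ∨ q' ≤ l) → (y ≤ p' ∨ q' ≤ y) → (m ≤ p' ∨ q' ≤ m) →
      (x ≤ p' ∨ q' ≤ x) → (r ≤ p' ∨ q' ≤ r) → ∀ v ∈ W, p' < v → v < q' → False := by
    intro p' q' h1 h2 h3 h4 h5 v hv h6 h7
    rcases hWmem.1 hv with rfl | rfl | rfl | rfl | rfl
    · rcases h1 with h1 | h1 <;> order
    · rcases h2 with h1 | h1 <;> order
    · rcases h3 with h1 | h1 <;> order
    · rcases h4 with h1 | h1 <;> order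
    · rcases h5 with h1 | h1 <;> order
  have g₁ := gap p l le_rfl (by order) l1 hpT mem_l
    (hemp (Or.inr le_rfl) (by right; order) (by right; order) (by right; order) (by right; order))
    (hpl.sep_left H sep₁) (Ne.symm hkl.2.1.1)
  have g₂ := gap l y (by order) (by order) l2 mem_l mem_y
    (hemp (Or.inl le_rfl) (by right; order) (by right; order) (by right; order) (by right; order))
    (hpl.sep_right H sep₁) nly
  have g₃ := gap y m (by order) (by order) l3 mem_y mem_m
    (hemp (by left; order) (by left; order) (by right; order) (by right; order) (by right; order))
    (hpm.sep_left H sep₂) nym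
  have g₄ := gap m x (by order) (by order) l4 mem_m mem_x
    (hemp (by left; order) (by left; order) (by left; order) (by right; order) (by right; order))
    (hpm.sep_right H sep₂) nmx
  have g₅ := gap x r (by order) (by order) l5 mem_x mem_r
    (hemp (by left; order) (by left; order) (by left; order) (by left; order) (by right; order))
    (hpr.sep_left H sep₃) (Ne.symm nrx)
  have g₆ := gap r q (by order) le_rfl l6 mem_r hqT
    (hemp (by left; order) (by left; order) (by left; order) (by left; order) (by left; order))
    (hpr.sep_right H sep₃) hkr.2.1.2
  have hdis : ∀ {a b a' b' : V}, b ≤ a' → Disjoint (Ioo a b) (Ioo a' b') := fun hba =>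
    Set.disjoint_left.2 fun v h1 h2 => lt_asymm (h1.2.trans_le hba) h2.1
  obtain ⟨d', he, hg⟩ := IsPartialColoring.fill_edges
    [(p, l), (l, y), (y, m), (m, x), (x, r), (r, q)] d (T ∪ W) good (by
      simp only [List.mem_cons, List.not_mem_nil, or_false, forall_eq_or_imp, forall_eq]
      exact ⟨⟨g₁, hpl.adj_left, hf _ _ (by order) (by order) (by right; order)⟩,
        ⟨g₂, hpl.adj_right.symm, hf _ _ (by order) (by order) (by left; order)⟩,
        ⟨g₃, hpm.adj_left, hf _ _ (by order) (by order) (by left; order)⟩,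
        ⟨g₄, hpm.adj_right.symm, hf _ _ (by order) (by order) (by left; order)⟩,
        ⟨g₅, hpr.adj_left, hf _ _ (by order) (by order) (by left; order)⟩,
        ⟨g₆, hpr.adj_right.symm, hf _ _ (by order) (by order) (by left; order)⟩⟩)
    (by
      simp only [List.pairwise_cons, List.mem_cons, List.not_mem_nil, or_false, forall_eq_or_imp,
        forall_eq, List.Pairwise.nil, and_true, IsEmpty.forall_iff, implies_true]
      refine ⟨⟨?_, ?_, ?_, ?_, ?_⟩, ⟨?_, ?_, ?_, ?_⟩, ⟨?_, ?_, ?_⟩, ⟨?_, ?_⟩, ?_⟩ <;>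
        apply hdis <;> order)
  refine ⟨d', (he.mono hTW).trans hd, ?_⟩
  convert hg using 1
  ext v
  simp only [mem_union, mem_ofPred_eq, hWmem, List.mem_cons, List.not_mem_nil, or_false,
    exists_eq_or_imp, exists_eq_left, mem_Ioo]
  rw [lt_and_lt_iff_of_chain l1 l2 l3 l4 l5 l6]
  simp only [or_assoc]

end Quadrilateral

end SimpleGraph

end

/-! ### Coloring the whole graph -/

section

open Set

namespace SimpleGraph

section Main

variable {V C : Type*} [Finite V] [LinearOrder V] {G : SimpleGraph V} {L : V → Finset C}

/-- Every gap with room can be colored, by induction on the number of vertices between its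
ends. -/
theorem IsConvexOnePlane.fillable (H : G.IsConvexOnePlane) (hL : ∀ v, 6 ≤ (L v).card) (p q : V) :
    Fillable G L p q := by
  induction hn : (Ioo p q).ncard using Nat.strong_induction_on generalizing p q with
  | _ n ih =>
  intro c T h hr
  subst hn
  have hf : ∀ p' q', p ≤ p' → q' ≤ q → p < p' ∨ q' < q → Fillable G L p' q' := by
    intro p' q' hp hq hne c' T' h'
    refine ih _ (ncard_lt_ncard ⟨Ioo_subset_Ioo hp hq, fun hsub => ?_⟩ (toFinite _)) p' q' rfl c' T'
      h'
    have hlt := h'.lt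
    rcases hne with hne | hne
    · exact lt_irrefl _ (hsub ⟨hne, hlt.trans_le hq⟩).1
    · exact lt_irrefl _ (hsub ⟨hp.trans_lt hlt, hne⟩).2
  by_cases hn : ∀ y, p < y → y < q → ¬ G.Adj p y
  · exact h.fill_of_forall_not_adj hL (fun x h1 _ => hf x q h1.le le_rfl (Or.inl h1)) hn
  push Not at hn
  obtain ⟨y₀, h1, h2, h3⟩ := hn
  obtain ⟨x, ⟨hpx, hxq, hadj⟩, hmax⟩ := exists_max_image {x | p < x ∧ x < q ∧ G.Adj p x} id
    (toFinite _) ⟨y₀, h1, h2, h3⟩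
  have hlast : ∀ y, x < y → y < q → ¬ G.Adj p y := fun y h4 h5 h6 =>
    (hmax y ⟨hpx.trans h4, h5, h6⟩).not_gt h4
  by_cases hnc : ∀ y z, p < y → y < x → x < z → ¬ G.Adj y z
  · exact h.fill_of_not_crossed hL hr hpx hxq (hf p x le_rfl hxq.le (Or.inr hxq))
      (hf x q hpx.le le_rfl (Or.inl hpx)) hadj hlast hnc
  push Not at hnc
  obtain ⟨y, z, hpy, hyx, hxz, hyz⟩ := hnc
  have hyq := hyx.trans hxq
  rcases (h.sep y z hpy hyq hyz).2.eq_or_lt with rfl | hzq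
  swap
  · have hpz := hpx.trans hxz
    exact h.fill_of_crossed H hL hpy hyx hxz hzq (hf p z le_rfl hzq.le (Or.inr hzq))
      (hf z q hpz.le le_rfl (Or.inl hpz)) hadj hyz hlast
  have hc := H.isCrossing h.sep hpy hyx hxz hadj hyz
  by_cases hsafe : (G.Adj p y ∨ (∀ l, ¬ IsPeak G p y l) ∨ 2 ≤ (seenColors G c T p).card) ∨
      (G.Adj x z ∨ (∀ r, ¬ IsPeak G x z r) ∨ 2 ≤ (seenColors G c T z).card) ∨
      (G.Adj y x ∨ ∀ m, ¬ IsPeak G y x m)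
  · exact h.fill_crossing hL hc (hf p y le_rfl hyq.le (Or.inr hyq))
      (hf y x hpy.le hxz.le (Or.inl hpy)) (hf x z hpx.le le_rfl (Or.inl hpx)) hsafe
  · push Not at hsafe
    obtain ⟨⟨npy, ⟨l, hl⟩, sp⟩, ⟨nxq, ⟨r, hr⟩, sq⟩, nyx, m, hm⟩ := hsafe
    exact h.fill_crossing_of_isPeak H hL hc hl hm hr npy nyx nxq (by omega) (by omega) hf

theorem IsConvexOnePlane.exists_isPartialColoring_univ (H : G.IsConvexOnePlane)
    (hL : ∀ v, 6 ≤ (L v).card) : ∃ c, IsPartialColoring G L c univ := by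
  classical
  have hdyn : ∀ (c : V → C) (T : Set V) (v : V), (∀ u ∈ T, ∀ w ∈ T, G.Adj v u → G.Adj v w → u = w) →
      IsDynamicAt G c T v := fun c T v h =>
    isDynamicAt_of_injOn fun u hu w hw _ => h u hu.1 w hw.1 hu.2 hw.2
  have hne : ∀ v, (L v).Nonempty := fun v => Finset.card_pos.1 (by have := hL v; omega)
  rcases subsingleton_or_nontrivial V with hV | hV
  · choose k hk using hne
    exact ⟨k, fun v _ => hk v, fun u _ v _ huv => absurd (Subsingleton.elim u v) huv.ne,
      fun v _ => hdyn _ _ _ fun _ _ _ _ _ _ => Subsingleton.elim _ _⟩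
  · -- start with the first and the last vertex
    obtain ⟨p, -, hp⟩ := exists_min_image (univ : Set V) id (toFinite _) univ_nonempty
    obtain ⟨q, -, hq⟩ := exists_max_image (univ : Set V) id (toFinite _) univ_nonempty
    simp only [mem_univ, id_eq, forall_const] at hp hq
    have hpq : p < q := by
      obtain ⟨a, b, hab⟩ := exists_pair_lt V
      exact (hp a).trans_lt (hab.trans_le (hq b))
    obtain ⟨k, hk⟩ := hne p
    obtain ⟨j, hj, hj'⟩ := Finset.exists_mem_notMem_of_card_lt_card (s := {k}) (t := L q)
      (by have := hL q; simp; omega)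
    rw [Finset.mem_singleton] at hj'
    let c : V → C := fun v => if v = p then k else j
    have hcp : c p = k := if_pos rfl
    have hcq : c q = j := if_neg hpq.ne'
    have good : IsPartialColoring G L c {p, q} := by
      refine ⟨?_, ?_, ?_⟩
      · rintro v (rfl | rfl)
        · rwa [hcp]
        · rwa [hcq]
      · rintro u (rfl | rfl) v (rfl | rfl) huv
        · exact absurd huv G.irrefl
        · rw [hcp, hcq]; exact Ne.symm hj'
        · rw [hcp, hcq]; exact hj'
        · exact absurd huv G.irrefl
      · rintro v (rfl | rfl) <;> refine hdyn _ _ _ ?_ <;>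
          rintro u (rfl | rfl) w (rfl | rfl) h1 h2 <;>
          first
          | rfl
          | exact absurd h1 G.irrefl
          | exact absurd h2 G.irrefl
    have gap : IsGap G L c {p, q} p q := by
      refine ⟨good, hpq, Or.inl rfl, Or.inr rfl, ?_, fun _ w _ _ _ => ⟨hp w, hq w⟩, ?_⟩
      · rintro v (rfl | rfl) h1 h2
        · exact lt_irrefl _ h1
        · exact lt_irrefl _ h2
      · rw [hcp, hcq]; exact Ne.symm hj'
    obtain ⟨c', -, hc'⟩ := H.fillable hL p q c _ gap
      (hasRoom_of_card_left (card_pendingColors_le_one (k := c q) fun i hi => by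
        obtain ⟨u, (rfl | rfl), hpu, rfl⟩ := mem_seenColors.1 hi
        · exact absurd hpu G.irrefl
        · rfl))
    refine ⟨c', ?_⟩
    convert hc' using 1
    refine (eq_univ_of_forall fun v => ?_).symm
    rcases (hp v).eq_or_lt with rfl | h1
    · exact Or.inl (Or.inl rfl)
    · rcases (hq v).eq_or_lt with rfl | h2
      · exact Or.inl (Or.inr rfl)
      · exact Or.inr ⟨h1, h2⟩

end Main

theorem IsPartialColoring.isDynamicColoring {V C : Type*} [Finite V] {G : SimpleGraph V}
    {L : V → Finset C} {c : V → C} (h : IsPartialColoring G L c univ) :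
    G.IsDynamicColoring 3 c := by
  refine ⟨fun u v huv => h.proper u trivial v trivial huv, fun v => ?_⟩
  have h1 := h.dynamic v trivial
  have h2 : {u | u ∈ (univ : Set V) ∧ G.Adj v u} = G.neighborSet v := by ext; simp
  unfold IsDynamicAt seenColors at h1
  rw [← ncard_eq_toFinset_card _ (toFinite _), h2] at h1
  rw [← (toFinite (G.neighborSet v)).cast_ncard_eq,
    ← (toFinite (c '' G.neighborSet v)).cast_ncard_eq]
  exact min_le_iff.2 ((min_le_iff.1 h1).imp (fun h => by exact_mod_cast h) fun h => by
    exact_mod_cast h)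

end SimpleGraph

end

theorem theorem3p2 {V : Type*} [Finite V] (G : SimpleGraph V) (hG : G.IsOuterOnePlanar) :
    G.IsDynamicChoosable 3 6 ∧ G.listDynamicChromaticNumber 3 ≤ 6 := by
  obtain ⟨_, H⟩ := hG.exists_isConvexOnePlane
  have h6 : G.IsDynamicChoosable 3 6 := by
    intro C L hL
    obtain ⟨c, hc⟩ := H.exists_isPartialColoring_univ (L := L) fun v => (hL v).ge
    exact ⟨c, fun v => hc.mem v trivial, hc.isDynamicColoring⟩
  exact ⟨h6, iInf₂_le (6 : ℕ) h6⟩
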